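/- **Model.** A cubical 3-dimensional mesh of edge length $s$ has the $s^3$ processors $\{0,\dots,s-1\}^3$, each linked to its at most six axis neighbours. Each processor has a fixed number $R$ of registers, each empty or holding one element of a set $V$ with two binary operations $\oplus,\otimes$, and a control state of a fixed number $w$ of words with $s^3+2$ possible values each. In one synchronous unit of time a processor sends at most one element over each link, stores elements it received, rearranges its registers, performs at most one operation $\oplus$ or $\otimes$ on registers, and updates its control state from its own, those of its neighbours, and the outcome of emptiness and equality tests on its registers. All processors of a program have the same transition rule, which may depend on $s$ and on the problem size, and an individual initial control state; elements of $V$ are only ever copied, moved, tested for equality, and combined by $\oplus$ and $\otimes$. A layout of $n\times n$ matrices places the entries at distinct processors. Given layouts of $A$, $B$ and $C$, a program computes the general product of $n\times n$ matrices within time $T$ if, for every $V$, every $\otimes$, every associative $\oplus$ and all $A,B\in V^{n\times n}$ (every entry stored once, by the layouts of $A$ and $B$), it halts after at most $T$ steps with $$C(i,j)=\bigoplus_{k=0}^{n-1}A(i,k)\otimes B(k,j)\qquad(0\le i,j<n,\ \text{summands in this order})$$ stored by the layout of $C$. Its (worst-case) running time is the least such $T$. **Algorithm A** for $n\times n$ matrices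 on the mesh of edge length $\lceil n^{\alpha/3}\rceil$ (size $n^\alpha$ up to rounding), $2\le\alpha\le 9/4$: halve the three index ranges and the three edges of the mesh $d=\lfloor(\alpha-2)\log_2 n\rfloor$ times, at each level assigning the product of blocks $A_{I,K}$, $B_{K,J}$ to the subcube $O_{I,K,J}$; compute the products of the last-level blocks (of side about $n^{3-\alpha}$) in their subcubes (of size about $n^{6-2\alpha}$); then, going back through the levels, add by $\oplus$ the results of the two halves of the summation range within the subcube of the respective subproblem. An implementation of Algorithm A is a program whose course does not depend on the entries and whose operations $\oplus,\otimes$ are exactly of these kinds, carried out in these subcubes. **Theorem.** (i) There are fixed $R$ and $w$ such that for every real $\alpha$ with $2\le\alpha\le 9/4$ there are constants $c_\alpha,C_\alpha>0$ for which the following holds for all $n\ge1$. Let $A$, $B$ be $n\times n$ matrices stored in any layouts in the corner subcube of edge length $\lceil n^{2/3}\rceil$ of the mesh of edge length $\lceil n^{\alpha/3}\rceil$, and let any layout in this corner be prescribed for the result. Then an implementation of Algorithm A with $R$ registers and $w$ control words per processor computes the general matrix product, with running time $T$ satisfying $c_\alpha n^{3-\alpha}\le T\le C_\alpha n^{3-\alpha}$.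 In particular the running time is $\Theta(n^{3/4})$ for $\alpha=9/4$. (ii) This is optimal: there is a constant $c>0$ such that for all $n$, all cubical 3-dimensional meshes of any size, all layouts of $A$, $B$ and $C$ in the mesh, and all $R$, $w$, every program that computes the general product of $n\times n$ matrices within time $T$ satisfies $T\ge c\,n^{3/4}$. -/

import Mathlib

universe u

namespace Mesh

/-! ### General matrix multiplication -/

/-- `x₀ ⊕ x₁ ⊕ ⋯`, in this order. No identity is assumed, so the empty sum is `none`. -/
def orderedSum {V : Type*} (add : V → V → V) : List V → Option V
  | [] => none
  | x :: xs => some (xs.foldl add x)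

/-- The entry `C(i,j) = ⨁_{k=0}^{n-1} A(i,k) ⊗ B(k,j)` of the general matrix product. -/
def generalProduct {V : Type*} {n : ℕ} (add mul : V → V → V)
    (A B : Matrix (Fin n) (Fin n) V) (i j : Fin n) : Option V :=
  orderedSum add ((List.finRange n).map fun k => mul (A i k) (B k j))

/-! ### The cubical mesh -/

/-- The processors of the cubical 3-dimensional mesh of edge length `s` (hence of size `s ^ 3`). -/
abbrev Proc (s : ℕ) := Fin 3 → Fin s

/-- The six directions: an axis, and whether the coordinate increases. -/
abbrev Dir := Fin 3 × Bool

/-- The opposite direction. -/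
def Dir.opp (d : Dir) : Dir := (d.1, !d.2)

/-- The neighbour of `p` in direction `d`, if there is one (the mesh does not wrap around). -/
def nbr {s : ℕ} (p : Proc s) (d : Dir) : Option (Proc s) :=
  if d.2 then
    if h : (p d.1 : ℕ) + 1 < s then some (Function.update p d.1 ⟨(p d.1 : ℕ) + 1, h⟩) else none
  else
    if (p d.1 : ℕ) = 0 then none
    else some (Function.update p d.1
      ⟨(p d.1 : ℕ) - 1, lt_of_le_of_lt (Nat.sub_le _ _) (p d.1).isLt⟩)

/-! ### Mesh programs

Every processor has `R` registers, each of which is empty or holds one matrix-type word (an element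
of the carrier `V`), and a control state, consisting of `w` words of `O(log p)` bits on a mesh
with `p` processors. The elements of `V` can be copied, moved, tested for equality and
combined by `⊕` and `⊗`. -/

/-- What is put into a register in the communication half of a time step: the content of one of the
processor's own registers, the word received from the neighbour in some direction, or nothing. -/
inductive Source (R : ℕ)
  | own (r : Fin R)
  | inbox (d : Dir)
  | clear

inductive OpKind
  | plus
  | times

/-- The instruction `dest := left ⊕ right` or `dest := left ⊗ right` on registers. -/
structure Instr (R : ℕ) where
  kind : OpKind
  left : Fin R
  right : Fin R
  dest : Fin R

/-- What a processor does in one time step: it sends at most one word over each of its links, loads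
its registers, and then performs at most one operation `⊕` or `⊗`. -/
structure Action (R : ℕ) where
  send : Dir → Option (Fin R)
  load : Fin R → Source R
  op : Option (Instr R)

/-- A program for the mesh of edge length `s`, with `R` registers and `w` control words per
processor. All processors have the same transition rule; they differ by their
initial control state, which may contain their coordinates. -/
structure Program (s R w : ℕ) where
  /-- The control states. -/
  Ctrl : Type
  finite_ctrl : Finite Ctrl
  /-- A control state fits into `w` words with `s ^ 3 + 2` possible values each. -/
  card_ctrl : Nat.card Ctrl ≤ (s ^ 3 + 2) ^ w
  init : Proc s → Ctrl
  act : Ctrl → Action R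
  /-- The new control state, computed from the old one, those of the neighbours, and the outcome of
  testing which registers are full and which pairs of registers have the same content. -/
  next : Ctrl → (Dir → Option Ctrl) → (Fin R → Bool) → (Fin R → Fin R → Bool) → Ctrl
  halted : Ctrl → Bool
  /-- The registers where the entries of `A`, `B` are found and those of `C` are to be put. -/
  regA : Fin R
  regB : Fin R
  regC : Fin R
  regA_ne_regB : regA ≠ regB

/-- The state of the whole mesh. -/
structure Config (s R : ℕ) (Q V : Type*) where
  ctrl : Proc s → Q
  reg : Proc s → Fin R → Option V

/-- An assignment of the entries of an `n × n` matrix to processors, at most one per processor. -/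
abbrev Layout (n s : ℕ) := (Fin n × Fin n) ↪ Proc s

/-- The entry of `M` stored at the processor `p` by the layout `L`, if any. -/
noncomputable def stored {V : Type*} {n s : ℕ} (L : Layout n s) (M : Matrix (Fin n) (Fin n) V)
    (p : Proc s) : Option V :=
  (Function.partialInv L p).map fun e => M e.1 e.2

namespace Program

variable {s R w : ℕ} (P : Program s R w) {V : Type*} (add mul : V → V → V)

/-- The word that `p` receives from its neighbour in direction `d`. -/
def received (c : Config s R P.Ctrl V) (p : Proc s) (d : Dir) : Option V :=
  (nbr p d).bind fun q => ((P.act (c.ctrl q)).send d.opp).bind fun r => c.reg q r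

/-- The registers of `p` after the communication half of a time step. -/
def loaded (c : Config s R P.Ctrl V) (p : Proc s) (r : Fin R) : Option V :=
  match (P.act (c.ctrl p)).load r with
  | .own r' => c.reg p r'
  | .inbox d => P.received c p d
  | .clear => none

/-- The registers of `p` after a whole time step. An operation with an empty operand has an
empty result. -/
def computed (c : Config s R P.Ctrl V) (p : Proc s) : Fin R → Option V :=
  match (P.act (c.ctrl p)).op with
  | none => P.loaded c p
  | some I =>
    let f := match I.kind with
      | .plus => add
      | .times => mul
    Function.update (P.loaded c p) I.dest (Option.map₂ f (P.loaded c p I.left) (P.loaded c p I.right))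

open Classical in
/-- One synchronous time step of the mesh. -/
noncomputable def step (c : Config s R P.Ctrl V) : Config s R P.Ctrl V where
  ctrl p := P.next (c.ctrl p) (fun d => (nbr p d).map c.ctrl)
    (fun r => (c.reg p r).isSome) (fun r r' => decide (c.reg p r = c.reg p r'))
  reg p := P.computed add mul c p

/-- The initial state: the entries of `A` and `B` are placed according to the layouts, and all other
registers are empty. -/
noncomputable def start {n : ℕ} (LA LB : Layout n s) (A B : Matrix (Fin n) (Fin n) V) :
    Config s R P.Ctrl V where
  ctrl := P.init
  reg p r := if r = P.regA then stored LA A p else if r = P.regB then stored LB B p else none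

/-- The state after `t` time steps. -/
noncomputable def run {n : ℕ} (LA LB : Layout n s) (A B : Matrix (Fin n) (Fin n) V) (t : ℕ) :
    Config s R P.Ctrl V :=
  (P.step add mul)^[t] (P.start LA LB A B)

/-- All processors have halted. -/
def AllHalted (c : Config s R P.Ctrl V) : Prop := ∀ p, P.halted (c.ctrl p) = true

/-- The computation ends after exactly `t` time steps. -/
def HaltsAt {n : ℕ} (LA LB : Layout n s) (A B : Matrix (Fin n) (Fin n) V) (t : ℕ) : Prop :=
  P.AllHalted (P.run add mul LA LB A B t) ∧ ∀ t' < t, ¬ P.AllHalted (P.run add mul LA LB A B t')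

/-- `P` is a correct program for general matrix multiplication of `n × n` matrices, with inputs
placed by `LA`, `LB` and output placed by `LC`, and its worst-case running time is at most `T`. -/
def ComputesWithin {s R w : ℕ} (P : Program s R w) {n : ℕ} (LA LB LC : Layout n s)
    (T : ℕ) : Prop :=
  ∀ (V : Type u) (add mul : V → V → V),
    (∀ x y z, add (add x y) z = add x (add y z)) →
    ∀ A B : Matrix (Fin n) (Fin n) V, ∃ t ≤ T, P.HaltsAt add mul LA LB A B t ∧
      ∀ i j, (P.run add mul LA LB A B t).reg (LC (i, j)) P.regC = generalProduct add mul A B i j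

/-- In the state `c` the processor `p` is about to apply the operation `kind` to `u` and `v`. -/
def Executes (c : Config s R P.Ctrl V) (p : Proc s) (kind : OpKind) (u v : V) : Prop :=
  ∃ I, (P.act (c.ctrl p)).op = some I ∧ I.kind = kind ∧
    P.loaded c p I.left = some u ∧ P.loaded c p I.right = some v

end Program

/-! ### Algorithm A

The algorithm halves the index ranges of the matrices and the edges of the mesh `depth` times.
After `r` halvings the product of the blocks `A_{I,K}` and `B_{K,J}` is the task of the subcube
`O_{I,K,J}`. The products of blocks at the last level are computed within the subcubes, and the results
are then added recursively. We express this by the operations that the program carries out when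
it is run on matrices of formal symbols. -/

/-- Formal expressions in the entries of two `n × n` matrices. -/
inductive Term (n : ℕ)
  | entryA (i k : Fin n)
  | entryB (k j : Fin n)
  | plus (u v : Term n)
  | times (u v : Term n)

/-- The index of the part that contains `x` after the range `0, …, N - 1` has been halved `r` times
(halves differ in length by rounding only). -/
def part (N r x : ℕ) : ℕ := 2 ^ r * x / N

/-- After `r` halvings, the product `A(i,k) ⊗ B(k,j)` belongs to the subcube that contains `p`. -/
def InSubcube {n s : ℕ} (r : ℕ) (p : Proc s) (i k j : Fin n) : Prop :=
  part n r i = part s r (p 0) ∧ part n r k = part s r (p 1) ∧ part n r j = part s r (p 2)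

/-- `PartialSum i j lo hi u`: the expression `u` is `⨁_{lo ≤ k < hi} A(i,k) ⊗ B(k,j)`, with the
summands in this order and brackets of any form. -/
inductive PartialSum {n : ℕ} (i j : Fin n) : ℕ → ℕ → Term n → Prop
  | single (k : Fin n) : PartialSum i j k (k + 1) (.times (.entryA i k) (.entryB k j))
  | plus {lo mid hi : ℕ} {u v : Term n} (hu : PartialSum i j lo mid u)
      (hv : PartialSum i j mid hi v) : PartialSum i j lo hi (.plus u v)

/-- The scalar product `u ⊗ v` at `p` is `A(i,k) ⊗ B(k,j)`, and after `d` halvings it belongs to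
the subcube of `p`. -/
def AllowedTimes {n s : ℕ} (d : ℕ) (p : Proc s) (u v : Term n) : Prop :=
  ∃ i k j : Fin n, u = .entryA i k ∧ v = .entryB k j ∧ InSubcube d p i k j

/-- The addition `u ⊕ v` at `p` joins two consecutive partial sums of one entry `C(i,j)`: either it
belongs to the multiplication of two blocks at the last level and takes place in their subcube, or
it adds the results of the two halves of the summation range of a subproblem at an earlier level `r`
and takes place in the subcube of this subproblem. -/
def AllowedPlus {n s : ℕ} (d : ℕ) (p : Proc s) (u v : Term n) : Prop :=
  ∃ (i j : Fin n) (lo mid hi : ℕ), PartialSum i j lo mid u ∧ PartialSum i j mid hi v ∧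
    ((∀ k : Fin n, lo ≤ k ∧ k < hi → InSubcube d p i k j) ∨
      ∃ r < d, (∀ k : Fin n, (lo ≤ k ∧ k < hi) ↔ InSubcube r p i k j) ∧
        ∀ k : Fin n, (lo ≤ k ∧ k < mid) ↔ (InSubcube r p i k j ∧ part n (r + 1) k % 2 = 0))

/-- `P` is an implementation of Algorithm A with `d` levels of recursion: the course of the
computation is fixed in advance (it does not depend on the entries), and all operations are those of the
recursive scheme, carried out in the right subcubes. -/
def Program.FollowsAlgorithmA {s R w : ℕ} (P : Program s R w) {n : ℕ} (LA LB : Layout n s)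
    (d : ℕ) : Prop :=
  (∀ q N full full' same same', P.next q N full same = P.next q N full' same') ∧
  let c := P.run Term.plus Term.times LA LB (Matrix.of Term.entryA) (Matrix.of Term.entryB)
  ∀ t, (∀ t' ≤ t, ¬ P.AllHalted (c t')) → ∀ (p : Proc s) (u v : Term n),
    (P.Executes (c t) p .times u v → AllowedTimes d p u v) ∧
    (P.Executes (c t) p .plus u v → AllowedPlus d p u v)

/-! ### Sizes -/

/-- The edge length of the mesh of size `n ^ α`, rounded up. -/
noncomputable def edge (α : ℝ) (n : ℕ) : ℕ := ⌈(n : ℝ) ^ (α / 3)⌉₊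

/-- The number `(α - 2) lg n` of levels of recursion, rounded down; it leads to about
`n ^ (3 α - 6)` subcubes of size about `n ^ (6 - 2 α)`. -/
noncomputable def depth (α : ℝ) (n : ℕ) : ℕ := ⌊(α - 2) * Real.logb 2 n⌋₊

/-- The matrix is stored in the corner of the mesh, in the smallest cube that can hold it. -/
def Layout.InCorner {n s : ℕ} (L : Layout n s) : Prop :=
  ∀ e a, (L e a : ℕ) < edge 2 n

/-- On a mesh of size `n ^ α`, for two `n × n` matrices given in the corner in any arrangement,
Algorithm A computes the general matrix product, delivers it in any arrangement wanted in the corner,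
and its worst-case running time is `Θ(n ^ β)`; it needs `R` registers and `w` control words
per processor. -/
def AlgorithmATakesTheta (R w : ℕ) (α β : ℝ) : Prop :=
  ∃ c C : ℝ, 0 < c ∧ 0 < C ∧ ∀ n : ℕ, 1 ≤ n → ∀ LA LB LC : Layout n (edge α n),
    LA.InCorner → LB.InCorner → LC.InCorner →
    ∃ (P : Program (edge α n) R w) (T : ℕ), P.FollowsAlgorithmA LA LB (depth α n) ∧
      IsLeast {T' : ℕ | Program.ComputesWithin.{u} P LA LB LC T'} T ∧
      c * (n : ℝ) ^ β ≤ T ∧ (T : ℝ) ≤ C * (n : ℝ) ^ β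

end Mesh

/-! Lower bound. Let the elements of `V` record their provenance: which entry they are, or which
scalar products they contain. A correct program must carry out all `n ^ 3` scalar products. A word
moves one link per step, so within time `T` the product with indices `(i,k,j)` is made within
distance `T` of the places of `A(i,k)`, `B(k,j)` and `C(i,j)`. A chain of products sharing entries
shows that all of them are made within distance `5 T` of one processor. A processor performs one
operation per step, hence `n ^ 3 ≤ (10 T + 1) ^ 3 * T` (`cube_le_of_computesWithin`), and so `T` is
at least of order `n ^ (3/4)`.

Upper bound. The course is fixed in advance, so it suffices to run it on formal expressions:
evaluation is a homomorphism and commutes with every step (`traj_mapRegs`), and associativity makes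
the bracketing of a sum irrelevant (`PartialSum.generalProduct_eq`). Time bounds are derived in a
small calculus of composition and loops for `Reach`. A finished derivation becomes a program whose
control state holds coordinates and a clock (`exists_program_of_reach`).

Write `d` for the depth, `L = s / 2 ^ d` for the edge of a subcube and `l` for the rounded-down
square root of `L`. A block has side about `X = n ^ (3 - α)`, and `X ^ 2` is about `L ^ 3`, so its
entries just fit into a subcube. A block is cut into a bounded number of chunks of side `L * l`,
each consisting of `l * l` squares of side `L`, one square per layer. Two chunks are multiplied in
`l` rounds; in each round every layer fetches one square of `A` and one of `B` and multiplies them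
systolically in `O(L)` steps (`reach_layer_product`, `reach_round`). This takes `O(L * l) = O(X)`
steps.

The entries reach their places by routing. Any permutation of the mesh splits into five motions
along axes, by edge colourings of regular bipartite multigraphs (`exists_five_phase`), and takes
`O(s)` steps. The distances in the recursive addition form a geometric series, so it takes `O(s +
d)` steps (`reach_tree`). Since `s` is about `n ^ (α / 3)`, all this is `O(X)` exactly because `α /
3 ≤ 3 - α`, that is, `α ≤ 9 / 4`. -/

namespace Mesh

/-! ### Schedules

A schedule prescribes an action for every processor and every time step. -/

section Schedule

variable {s R n : ℕ} {V W : Type*}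

/-- The word that `p` receives from direction `d` when every processor `q` carries out `g q`. -/
def receive (g : Proc s → Action R) (σ : Proc s → Fin R → Option V) (p : Proc s) (d : Dir) :
    Option V :=
  (nbr p d).bind fun q => ((g q).send d.opp).bind fun r => σ q r

/-- The registers after the communication half of a step. -/
def loadRegs (g : Proc s → Action R) (σ : Proc s → Fin R → Option V) (p : Proc s) (r : Fin R) :
    Option V :=
  match (g p).load r with
  | .own r' => σ p r'
  | .inbox d => receive g σ p d
  | .clear => none

/-- The operation denoted by an `OpKind`. -/
def OpKind.fn (add mul : V → V → V) : OpKind → V → V → V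
  | .plus => add
  | .times => mul

/-- The registers after one step. -/
def execStep (add mul : V → V → V) (g : Proc s → Action R) (σ : Proc s → Fin R → Option V)
    (p : Proc s) : Fin R → Option V :=
  match (g p).op with
  | none => loadRegs g σ p
  | some I => Function.update (loadRegs g σ p) I.dest
      (Option.map₂ (I.kind.fn add mul) (loadRegs g σ p I.left) (loadRegs g σ p I.right))

/-- The registers after `t` steps of a schedule. -/
def traj (add mul : V → V → V) (G : ℕ → Proc s → Action R) (σ : Proc s → Fin R → Option V) :
    ℕ → Proc s → Fin R → Option V
  | 0 => σ
  | t + 1 => execStep add mul (G t) (traj add mul G σ t)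

/-- Application of a map to the contents of all registers. -/
def mapRegs (φ : V → W) (σ : Proc s → Fin R → Option V) : Proc s → Fin R → Option W :=
  fun p r => (σ p r).map φ

lemma loadRegs_mapRegs (φ : V → W) (g : Proc s → Action R) (σ : Proc s → Fin R → Option V)
    (p : Proc s) (r : Fin R) :
    loadRegs g (mapRegs φ σ) p r = (loadRegs g σ p r).map φ := by
  unfold loadRegs
  cases (g p).load r with
  | own r' => rfl
  | clear => rfl
  | inbox d =>
    simp only [receive, mapRegs]
    cases nbr p d with
    | none => rfl
    | some q =>
      simp only [Option.bind_some]
      cases (g q).send d.opp <;> rfl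

lemma execStep_mapRegs {add mul : V → V → V} {add' mul' : W → W → W} {φ : V → W}
    (ha : ∀ x y, φ (add x y) = add' (φ x) (φ y)) (hm : ∀ x y, φ (mul x y) = mul' (φ x) (φ y))
    (g : Proc s → Action R) (σ : Proc s → Fin R → Option V) :
    execStep add' mul' g (mapRegs φ σ) = mapRegs φ (execStep add mul g σ) := by
  funext p r
  have hl : loadRegs g (mapRegs φ σ) p = fun r => (loadRegs g σ p r).map φ :=
    funext fun r => loadRegs_mapRegs φ g σ p r
  simp only [execStep, mapRegs]
  cases (g p).op with
  | none => simp [loadRegs_mapRegs]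
  | some I =>
    simp only [hl]
    by_cases hr : r = I.dest
    · subst hr
      simp only [Function.update_self]
      cases loadRegs g σ p I.left <;> cases loadRegs g σ p I.right <;>
        cases I.kind <;> simp [OpKind.fn, ha, hm]
    · simp [Function.update_of_ne hr]

/-- A schedule never inspects the contents of registers, so it commutes with every homomorphism.
With `Term.eval` as `φ`, one run on formal expressions decides the runs over all `V`. -/
lemma traj_mapRegs {add mul : V → V → V} {add' mul' : W → W → W} {φ : V → W}
    (ha : ∀ x y, φ (add x y) = add' (φ x) (φ y)) (hm : ∀ x y, φ (mul x y) = mul' (φ x) (φ y))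
    (G : ℕ → Proc s → Action R) (σ : Proc s → Fin R → Option V) (t : ℕ) :
    traj add' mul' G (mapRegs φ σ) t = mapRegs φ (traj add mul G σ t) := by
  induction t with
  | zero => rfl
  | succ t ih => simp only [traj, ih, execStep_mapRegs ha hm]

/-- Contents of registers that are formal expressions. -/
abbrev TermRegs (n s R : ℕ) := Proc s → Fin R → Option (Term n)

/-- One step on formal expressions. -/
abbrev termStep (g : Proc s → Action R) (σ : TermRegs n s R) : TermRegs n s R :=
  execStep Term.plus Term.times g σ

/-- All operations carried out in a step are those of Algorithm A with `d` levels. -/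
def StepAllowed (d : ℕ) (g : Proc s → Action R) (σ : TermRegs n s R) : Prop :=
  ∀ p I u v, (g p).op = some I → loadRegs g σ p I.left = some u →
    loadRegs g σ p I.right = some v →
    (I.kind = .times → AllowedTimes d p u v) ∧ (I.kind = .plus → AllowedPlus d p u v)

/-- From `σ` a state with the property `Q` can be reached within `T` steps, by operations of
Algorithm A with `d` levels only. -/
inductive Reach (d : ℕ) (Q : TermRegs n s R → Prop) : ℕ → TermRegs n s R → Prop
  | done {T : ℕ} {σ : TermRegs n s R} (h : Q σ) : Reach d Q T σ
  | step {T : ℕ} {σ : TermRegs n s R} (g : Proc s → Action R) (hg : StepAllowed d g σ)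
      (h : Reach d Q T (termStep g σ)) : Reach d Q (T + 1) σ

variable {d : ℕ} {Q Q' : TermRegs n s R → Prop} {σ : TermRegs n s R} {T T' : ℕ}

/-- Sequential composition; the time bounds add. Together with the loop rules this gives a
Hoare-style calculus in which all later stages are assembled. -/
lemma Reach.bind (h : Reach d Q T σ) (h' : ∀ τ, Q τ → Reach d Q' T' τ) :
    Reach d Q' (T + T') σ := by
  induction h with
  | @done T σ hQ =>
    have := h' _ hQ
    clear hQ h'
    induction this with
    | done h => exact .done h
    | step g hg _ ih => exact .step (T := _) g hg ih
  | @step T σ g hg _ ih =>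
    rw [Nat.add_right_comm]
    exact .step g hg ih

lemma Reach.weaken (h : Reach d Q T σ) (hT : T ≤ T') (hQ : ∀ τ, Q τ → Q' τ) :
    Reach d Q' T' σ := by
  obtain ⟨c, rfl⟩ := Nat.exists_eq_add_of_le hT
  exact h.bind fun τ hτ => .done (hQ τ hτ)

/-- The rule for loops. -/
lemma Reach.loop {Inv : ℕ → TermRegs n s R → Prop} (N : ℕ)
    (hbody : ∀ i < N, ∀ τ, Inv i τ → Reach d (Inv (i + 1)) T τ) (h0 : Inv 0 σ) :
    Reach d (Inv N) (N * T) σ := by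
  induction N with
  | zero => exact .done h0
  | succ N ih =>
    rw [Nat.succ_mul]
    exact (ih fun i hi => hbody i (by omega)).bind fun τ hτ => hbody N (by omega) τ hτ

/-- The rule for loops with passes of different length. -/
lemma Reach.loop_sum {Inv : ℕ → TermRegs n s R → Prop} (N : ℕ) (cost : ℕ → ℕ)
    (hbody : ∀ i < N, ∀ τ, Inv i τ → Reach d (Inv (i + 1)) (cost i) τ) (h0 : Inv 0 σ) :
    Reach d (Inv N) (∑ i ∈ Finset.range N, cost i) σ := by
  induction N with
  | zero => exact .done h0
  | succ N ih =>
    rw [Finset.sum_range_succ]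
    exact (ih fun i hi => hbody i (by omega)).bind fun τ hτ => hbody N (by omega) τ hτ

/-- The action that changes nothing. -/
def Action.idle (R : ℕ) : Action R := ⟨fun _ => none, .own, none⟩

lemma StepAllowed.of_op_none {g : Proc s → Action R} (h : ∀ p, (g p).op = none) :
    StepAllowed d g σ := fun p I u v hI => by simp [h] at hI

lemma execStep_of_op_none {add mul : V → V → V} {g : Proc s → Action R}
    {τ : Proc s → Fin R → Option V} {p : Proc s} (h : (g p).op = none) :
    execStep add mul g τ p = loadRegs g τ p := by
  simp [execStep, h]

/-- `Reach` only bounds the time from above; the schedule fills the remaining steps with idling, so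
its length is exactly `T`. -/
lemma Reach.exists_schedule (h : Reach d Q T σ) :
    ∃ G : ℕ → Proc s → Action R,
      (∀ t < T, StepAllowed d (G t) (traj Term.plus Term.times G σ t)) ∧
      Q (traj Term.plus Term.times G σ T) := by
  induction h with
  | @done T σ hQ =>
    refine ⟨fun _ _ => Action.idle R, fun t _ => .of_op_none fun _ => rfl, ?_⟩
    have : ∀ t, traj Term.plus Term.times (fun _ _ => Action.idle R) σ t = σ := by
      intro t
      induction t with
      | zero => rfl
      | succ t ih =>
        rw [traj, ih]
        rfl
    rwa [this]
  | @step T σ g hg _ ih =>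
    obtain ⟨G, h1, h2⟩ := ih
    let G' : ℕ → Proc s → Action R := fun t => Nat.casesOn t g G
    have key : ∀ t, traj Term.plus Term.times G' σ (t + 1) =
        traj Term.plus Term.times G (termStep g σ) t := by
      intro t
      induction t with
      | zero => rfl
      | succ t ih => rw [traj, ih]; rfl
    refine ⟨G', fun t ht => ?_, by rw [key]; exact h2⟩
    cases t with
    | zero => exact hg
    | succ t => rw [key]; exact h1 t (by omega)

end Schedule

/-! ### Evaluation of formal expressions -/

section Eval

variable {V : Type*} {n : ℕ}

/-- The value of a formal expression. -/
def Term.eval (add mul : V → V → V) (A B : Matrix (Fin n) (Fin n) V) : Term n → V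
  | .entryA i k => A i k
  | .entryB k j => B k j
  | .plus u v => add (u.eval add mul A B) (v.eval add mul A B)
  | .times u v => mul (u.eval add mul A B) (v.eval add mul A B)

/-- This is the only place where the associativity of `⊕` is put to work: the first operand is
pulled out of a left fold. -/
lemma orderedSum_append {add : V → V → V}
    (hadd : ∀ x y z, add (add x y) z = add x (add y z)) {l l' : List V} {a b : V}
    (hl : orderedSum add l = some a) (hl' : orderedSum add l' = some b) :
    orderedSum add (l ++ l') = some (add a b) := by
  have key : ∀ (ys : List V) (x y : V), ys.foldl add (add x y) = add x (ys.foldl add y) := by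
    intro ys
    induction ys with
    | nil => intros; rfl
    | cons z zs ih => intro x y; simp only [List.foldl_cons, hadd, ih]
  cases l with
  | nil => simp [orderedSum] at hl
  | cons x xs =>
    cases l' with
    | nil => simp [orderedSum] at hl'
    | cons y ys =>
      simp only [orderedSum, Option.some.injEq] at hl hl'
      simp [orderedSum, hl, key, hl']

/-- Induction on the bracketing. The summands are given by a function on all of `ℕ`, so that ranges
can be concatenated as lists; `lo < hi` is carried along because an empty sum has no value. -/
lemma PartialSum.orderedSum_eq {add mul : V → V → V}
    (hadd : ∀ x y z, add (add x y) z = add x (add y z)) {A B : Matrix (Fin n) (Fin n) V}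
    {i j : Fin n} {f : ℕ → V} (hf : ∀ k : Fin n, f k = mul (A i k) (B k j)) {lo hi : ℕ}
    {u : Term n} (h : PartialSum i j lo hi u) :
    lo < hi ∧ orderedSum add ((List.range' lo (hi - lo)).map f) =
      some (u.eval add mul A B) := by
  induction h with
  | single k => simp [orderedSum, Term.eval, hf]
  | @plus lo mid hi u v _ _ ihu ihv =>
    refine ⟨by omega, ?_⟩
    have : List.range' lo (hi - lo) = List.range' lo (mid - lo) ++ List.range' mid (hi - mid) := by
      have := List.range'_append (s := lo) (m := mid - lo) (n := hi - mid) (step := 1)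
      rw [one_mul, Nat.add_sub_cancel' ihu.1.le] at this
      rw [this]
      congr 1
      omega
    rw [this, List.map_append, orderedSum_append hadd ihu.2 ihv.2]
    rfl

lemma PartialSum.generalProduct_eq {add mul : V → V → V}
    (hadd : ∀ x y z, add (add x y) z = add x (add y z)) (A B : Matrix (Fin n) (Fin n) V)
    {i j : Fin n} {u : Term n} (h : PartialSum i j 0 n u) :
    generalProduct add mul A B i j = some (u.eval add mul A B) := by
  -- The value `A i i` beyond the range is arbitrary; it only supplies some element of `V`.
  let f : ℕ → V := fun k => if hk : k < n then mul (A i ⟨k, hk⟩) (B ⟨k, hk⟩ j) else A i i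
  have hf : ∀ k : Fin n, f k = mul (A i k) (B k j) := fun k => by simp [f]
  rw [← (h.orderedSum_eq hadd hf).2, generalProduct, Nat.sub_zero, ← List.range_eq_range',
    ← List.map_coe_finRange_eq_range, List.map_map]
  congr 1
  exact List.map_congr_left fun k _ => (hf k).symm

end Eval

/-! ### The program of a schedule -/

section ScheduleProgram

variable {s R w T n : ℕ}

/-- The program that follows a schedule for `T` steps: the control state consists of the
coordinates of the processor and a clock. -/
def scheduleProgram (G : ℕ → Proc s → Action R) (hw : s ^ 3 * (T + 1) ≤ (s ^ 3 + 2) ^ w)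
    (rA rB rC : Fin R) (hAB : rA ≠ rB) : Program s R w where
  Ctrl := Proc s × Fin (T + 1)
  finite_ctrl := inferInstance
  card_ctrl := by simpa using hw
  init p := (p, 0)
  act q := G q.2 q.1
  -- The clock stops at `T`. Ignoring neighbours and tests makes the course independent of the
  -- entries.
  next q _ _ _ := (q.1, ⟨min (q.2 + 1) T, by omega⟩)
  halted q := decide ((q.2 : ℕ) = T)
  regA := rA
  regB := rB
  regC := rC
  regA_ne_regB := hAB

/-- The initial registers, with `A` in the register `rA` and `B` in `rB`. -/
noncomputable def initialRegs {V : Type*} (rA rB : Fin R) (LA LB : Layout n s)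
    (A B : Matrix (Fin n) (Fin n) V) : Proc s → Fin R → Option V :=
  fun p r => if r = rA then stored LA A p else if r = rB then stored LB B p else none

variable {G : ℕ → Proc s → Action R} {hw : s ^ 3 * (T + 1) ≤ (s ^ 3 + 2) ^ w}
  {rA rB rC : Fin R} {hAB : rA ≠ rB} {LA LB LC : Layout n s}

lemma scheduleProgram_run {V : Type*} (add mul : V → V → V) (A B : Matrix (Fin n) (Fin n) V)
    {t : ℕ} (ht : t ≤ T) :
    (scheduleProgram G hw rA rB rC hAB).run add mul LA LB A B t =
      ⟨fun p => (p, ⟨t, by omega⟩), traj add mul G (initialRegs rA rB LA LB A B) t⟩ := by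
  induction t with
  | zero => rfl
  | succ t ih =>
    rw [Program.run, Function.iterate_succ_apply', ← Program.run, ih (by omega)]
    unfold Program.step
    congr 1
    · funext p
      simp only [scheduleProgram, Prod.mk.injEq, true_and, Fin.mk.injEq]
      omega

/-- Halting is read off the clock of any one processor; a mesh without processors would count as
halted at time 0. -/
lemma scheduleProgram_allHalted_iff {V : Type*} (hs : 0 < s) (add mul : V → V → V)
    (A B : Matrix (Fin n) (Fin n) V) {t : ℕ} (ht : t ≤ T) :
    (scheduleProgram G hw rA rB rC hAB).AllHalted
      ((scheduleProgram G hw rA rB rC hAB).run add mul LA LB A B t) ↔ t = T := by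
  rw [scheduleProgram_run add mul A B ht]
  simp only [Program.AllHalted, scheduleProgram, decide_eq_true_eq]
  exact ⟨fun h => h fun _ => ⟨0, hs⟩, fun h _ => h⟩

lemma initialRegs_eval {V : Type*} (add mul : V → V → V) (A B : Matrix (Fin n) (Fin n) V) :
    (initialRegs rA rB LA LB A B : Proc s → Fin R → Option V) =
      mapRegs (Term.eval add mul A B)
        (initialRegs rA rB LA LB (Matrix.of Term.entryA) (Matrix.of Term.entryB)) := by
  funext p r
  simp only [initialRegs, mapRegs]
  split_ifs
  · simp [stored, Function.comp_def, Term.eval]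
  · simp [stored, Function.comp_def, Term.eval]
  · rfl

/-- A schedule on formal expressions that is correct and consists of operations of Algorithm A
yields an implementation of Algorithm A. -/
lemma exists_program_of_reach (hs : 0 < s) {d : ℕ} (hw : s ^ 3 * (T + 1) ≤ (s ^ 3 + 2) ^ w)
    (hAB : rA ≠ rB)
    (h : Reach d (fun σ => ∀ i j, ∃ u, σ (LC (i, j)) rC = some u ∧ PartialSum i j 0 n u) T
      (initialRegs rA rB LA LB (Matrix.of Term.entryA) (Matrix.of Term.entryB))) :
    ∃ P : Program s R w, P.FollowsAlgorithmA LA LB d ∧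
      IsLeast {T' : ℕ | Program.ComputesWithin.{u} P LA LB LC T'} T := by
  obtain ⟨G, hG, hQ⟩ := h.exists_schedule
  refine ⟨scheduleProgram G hw rA rB rC hAB, ⟨fun _ _ _ _ _ _ => rfl, ?_⟩, ?_, ?_⟩
  · intro c t ht p u v
    have htT : t < T := by
      by_contra hcon
      exact ht T (by omega) ((scheduleProgram_allHalted_iff hs _ _ _ _ le_rfl).2 rfl)
    simp only [c, scheduleProgram_run _ _ _ _ htT.le]
    refine ⟨?_, ?_⟩
    · rintro ⟨I, h1, h2, h3, h4⟩
      exact (hG t htT p I u v h1 h3 h4).1 h2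
    · rintro ⟨I, h1, h2, h3, h4⟩
      exact (hG t htT p I u v h1 h3 h4).2 h2
  · intro V add mul hadd A B
    refine ⟨T, le_rfl, ⟨(scheduleProgram_allHalted_iff hs _ _ _ _ le_rfl).2 rfl, fun t' ht' h' =>
      ht'.ne ((scheduleProgram_allHalted_iff hs _ _ _ _ ht'.le).1 h')⟩, fun i j => ?_⟩
    rw [scheduleProgram_run _ _ _ _ le_rfl, initialRegs_eval add mul,
      traj_mapRegs (add := Term.plus) (mul := Term.times) (fun _ _ => rfl) (fun _ _ => rfl)]
    obtain ⟨u, hu, hs⟩ := hQ i j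
    rw [hs.generalProduct_eq hadd A B]
    simp only [mapRegs, scheduleProgram, hu, Option.map_some]
  · intro T' hT'
    -- Minimality of `T`: the clock stops at `T` on every input, so a carrier with one element
    -- already refutes a smaller bound.
    obtain ⟨t, htT', ⟨h1, -⟩, -⟩ := hT' PUnit (fun _ _ => ⟨⟩) (fun _ _ => ⟨⟩) (fun _ _ _ => rfl)
      (fun _ _ => ⟨⟩) (fun _ _ => ⟨⟩)
    by_contra hcon
    have := (scheduleProgram_allHalted_iff hs _ _ _ _ (by omega : t ≤ T)).1 h1
    omega

end ScheduleProgram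

/-! ### The lower bound -/

section LowerBound

/-- The processors `p` and `q` differ by at most `t` in every coordinate. -/
def Near {s : ℕ} (t : ℕ) (p q : Proc s) : Prop :=
  ∀ a, (p a : ℕ) ≤ q a + t ∧ (q a : ℕ) ≤ p a + t

lemma Near.symm {s t : ℕ} {p q : Proc s} (h : Near t p q) : Near t q p :=
  fun a => ⟨(h a).2, (h a).1⟩

lemma Near.trans {s t t' : ℕ} {p q q' : Proc s} (h : Near t p q) (h' : Near t' q q') :
    Near (t + t') p q' :=
  fun a => by have := h a; have := h' a; omega

lemma Near.mono {s t t' : ℕ} {p q : Proc s} (h : Near t p q) (ht : t ≤ t') : Near t' p q :=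
  fun a => by have := h a; omega

lemma Near.refl {s : ℕ} (t : ℕ) (p : Proc s) : Near t p p := fun a => by omega

lemma near_of_nbr {s : ℕ} {p q : Proc s} {d : Dir} (h : nbr p d = some q) : Near 1 p q := by
  intro a
  unfold nbr at h
  split_ifs at h <;> cases h <;> by_cases ha : a = d.1
  · subst ha; simp; omega
  · simp [Function.update_of_ne ha]
  · subst ha; simp; omega
  · simp [Function.update_of_ne ha]

lemma card_near_le {s : ℕ} (p : Proc s) (t : ℕ) (S : Finset (Proc s)) (hS : ∀ q ∈ S, Near t q p) :
    S.card ≤ (2 * t + 1) ^ 3 := by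
  have : S.card ≤ (Finset.univ : Finset (Fin 3 → Fin (2 * t + 1))).card := by
    -- The shifted differences lie between 0 and `2 t`, so the reduction modulo `2 t + 1` changes
    -- nothing.
    refine Finset.card_le_card_of_injOn
      (fun q a => Fin.ofNat (2 * t + 1) ((q a : ℕ) + t - p a)) (fun _ _ => Finset.mem_univ _) ?_
    intro q hq q' hq' h
    funext a
    have h := congrArg Fin.val (congrFun h a)
    have h1 := hS q hq a
    have h2 := hS q' hq' a
    simp only [Fin.val_ofNat] at h
    rw [Nat.mod_eq_of_lt (by omega), Nat.mod_eq_of_lt (by omega)] at h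
    ext
    omega
  simpa using this

/-- Elements that record from which entry they come, or which scalar products
`A(i,k) ⊗ B(k,j)` they contain. -/
structure Provenance (n : ℕ) : Type u where
  products : Set (Fin n × Fin n × Fin n)
  entryOfA : Option (Fin n × Fin n)
  entryOfB : Option (Fin n × Fin n)

namespace Provenance

variable {n : ℕ}

/-- Addition unites the recorded products. -/
def add (x y : Provenance.{u} n) : Provenance.{u} n := ⟨x.products ∪ y.products, none, none⟩

/-- Multiplication records the product of an entry of `A` and a matching entry of `B`. -/
def mul (x y : Provenance.{u} n) : Provenance.{u} n :=
  ⟨{τ | x.entryOfA = some (τ.1, τ.2.1) ∧ y.entryOfB = some (τ.2.1, τ.2.2)}, none, none⟩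

lemma add_assoc (x y z : Provenance.{u} n) : add (add x y) z = add x (add y z) := by
  simp [add, Set.union_assoc]

/-- The matrix `A`. -/
def matA (n : ℕ) : Matrix (Fin n) (Fin n) (Provenance.{u} n) := fun i k => ⟨∅, some (i, k), none⟩

/-- The matrix `B`. -/
def matB (n : ℕ) : Matrix (Fin n) (Fin n) (Provenance.{u} n) := fun k j => ⟨∅, none, some (k, j)⟩

/-- Addition never forgets a product. Results of operations carry no entry tags, so a product is
recorded only when an entry of `A` itself meets an entry of `B` itself. -/
lemma mem_generalProduct (i k j : Fin n) : ∃ x, generalProduct add mul (matA.{u} n) (matB n) i j =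
    some x ∧ (i, k, j) ∈ x.products := by
  have fold : ∀ (l : List (Provenance.{u} n)) (x : Provenance.{u} n) (τ : Fin n × Fin n × Fin n),
      (τ ∈ x.products ∨ ∃ y ∈ l, τ ∈ y.products) → τ ∈ (l.foldl add x).products := by
    intro l
    induction l with
    | nil => intro x τ h; simpa using h
    | cons z zs ih =>
      intro x τ h
      refine ih _ _ ?_
      simp only [List.mem_cons, exists_eq_or_imp] at h
      simp only [add, Set.mem_union]
      tauto
  unfold generalProduct
  have hmem : mul (matA n i k) (matB n k j) ∈
      (List.finRange n).map fun k => mul (matA.{u} n i k) (matB n k j) :=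
    List.mem_map.2 ⟨k, List.mem_finRange k, rfl⟩
  have hk : (i, k, j) ∈ (mul (matA.{u} n i k) (matB n k j)).products := by
    simp [mul, matA, matB]
  generalize (List.finRange n).map (fun k => mul (matA.{u} n i k) (matB n k j)) = l at hmem
  cases l with
  | nil => simp at hmem
  | cons x xs =>
    refine ⟨_, rfl, fold _ _ _ ?_⟩
    rcases List.mem_cons.1 hmem with h | h
    · exact .inl (h ▸ hk)
    · exact .inr ⟨_, h, hk⟩

end Provenance

open Provenance

variable {s R w n : ℕ} (P : Program s R w) (LA LB LC : Layout n s)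

/-- The computation on the matrices that record the provenance. -/
noncomputable abbrev provRun (t : ℕ) : Config s R P.Ctrl (Provenance.{u} n) :=
  P.run add mul LA LB (matA n) (matB n) t

/-- The scalar product `τ` is computed at the processor `q` in the step after time `t`. -/
def Makes (q : Proc s) (t : ℕ) (τ : Fin n × Fin n × Fin n) : Prop :=
  ∃ x y, P.Executes (provRun.{u} P LA LB t) q .times x y ∧ τ ∈ (mul x y).products

variable {P LA LB}

/-- A processor performs at most one operation per step, and the tags of the two operands determine
all three indices. -/
lemma Makes.unique {q : Proc s} {t : ℕ} {τ τ' : Fin n × Fin n × Fin n}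
    (h : Makes.{u} P LA LB q t τ) (h' : Makes.{u} P LA LB q t τ') : τ = τ' := by
  obtain ⟨x, y, ⟨I, hI, -, hx, hy⟩, hτ⟩ := h
  obtain ⟨x', y', ⟨I', hI', -, hx', hy'⟩, hτ'⟩ := h'
  obtain rfl : I = I' := by simpa [hI] using hI'
  obtain rfl : x = x' := by simpa [hx] using hx'
  obtain rfl : y = y' := by simpa [hy] using hy'
  obtain ⟨i, k, j⟩ := τ
  obtain ⟨i', k', j'⟩ := τ'
  have a := hτ.1.symm.trans hτ'.1
  have b := hτ.2.symm.trans hτ'.2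
  simp_all

lemma exists_reg_of_loaded {V : Type*} {c : Config s R P.Ctrl V} {p : Proc s} {r : Fin R} {x : V}
    (h : P.loaded c p r = some x) : ∃ q r', Near 1 p q ∧ c.reg q r' = some x := by
  unfold Program.loaded at h
  split at h
  · exact ⟨p, _, .refl _ _, h⟩
  · simp only [Program.received, Option.bind_eq_some_iff] at h
    obtain ⟨q, hq, r', -, h⟩ := h
    exact ⟨q, r', near_of_nbr hq, h⟩
  · simp at h

/-- What is known about an element at the processor `p` at time `t`. -/
structure Localized (P : Program s R w) (LA LB : Layout n s) (t : ℕ) (p : Proc s)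
    (x : Provenance.{u} n) : Prop where
  nearA : ∀ e, x.entryOfA = some e → Near t p (LA e)
  nearB : ∀ e, x.entryOfB = some e → Near t p (LB e)
  made : ∀ τ ∈ x.products, ∃ q, ∃ t' < t, Makes.{u} P LA LB q t' τ ∧ Near t p q ∧
    Near t q (LA (τ.1, τ.2.1)) ∧ Near t q (LB (τ.2.1, τ.2.2))

lemma Localized.step {t : ℕ} {p q : Proc s} {x : Provenance.{u} n} (h : Localized P LA LB t q x)
    (hpq : Near 1 p q) : Localized P LA LB (t + 1) p x where
  nearA e he := (hpq.trans (h.nearA e he)).mono (by omega)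
  nearB e he := (hpq.trans (h.nearB e he)).mono (by omega)
  made τ hτ := by
    obtain ⟨q', t', ht', h1, h2, h3, h4⟩ := h.made τ hτ
    exact ⟨q', t', by omega, h1, (hpq.trans h2).mono (by omega), h3.mono (by omega),
      h4.mono (by omega)⟩

lemma partialInv_eq_some {L : Layout n s} {p : Proc s} {e : Fin n × Fin n}
    (h : Function.partialInv L p = some e) : L e = p :=
  (L.injective.isPartialInv e p).1 h

/-- Induction on time: a loaded word comes from a processor at most one link away, which costs 1 in
every distance. A product that is new at `p` was made at `p` from two operands that are themselves
localized. -/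
lemma localized_run (t : ℕ) (p : Proc s) (r : Fin R) (x : Provenance.{u} n)
    (h : (provRun.{u} P LA LB t).reg p r = some x) : Localized P LA LB t p x := by
  induction t generalizing p r x with
  | zero =>
    simp only [provRun, Program.run, Function.iterate_zero, id, Program.start] at h
    split_ifs at h
    · simp only [stored, Option.map_eq_some_iff] at h
      obtain ⟨e, he, rfl⟩ := h
      have := partialInv_eq_some he
      subst this
      refine ⟨fun e' he' => ?_, fun e' he' => by simp [matA] at he', fun τ hτ => by simp [matA] at hτ⟩
      simp only [matA, Option.some.injEq] at he'
      subst he'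
      exact .refl _ _
    · simp only [stored, Option.map_eq_some_iff] at h
      obtain ⟨e, he, rfl⟩ := h
      have := partialInv_eq_some he
      subst this
      refine ⟨fun e' he' => by simp [matB] at he', fun e' he' => ?_, fun τ hτ => by simp [matB] at hτ⟩
      simp only [matB, Option.some.injEq] at he'
      subst he'
      exact .refl _ _
  | succ t ih =>
    have hload : ∀ r x, P.loaded (provRun.{u} P LA LB t) p r = some x →
        Localized P LA LB (t + 1) p x := by
      intro r x hx
      obtain ⟨q, r', hq, hr'⟩ := exists_reg_of_loaded hx
      exact (ih q r' x hr').step hq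
    rw [provRun, Program.run, Function.iterate_succ_apply', ← Program.run] at h
    simp only [Program.step, Program.computed] at h
    cases hI : (P.act ((provRun.{u} P LA LB t).ctrl p)).op with
    | none => exact hload r x (by simpa only [hI] using h)
    | some I =>
      simp only [hI] at h
      by_cases hr : r = I.dest
      · rw [hr, Function.update_self, Option.map₂_eq_some_iff] at h
        obtain ⟨y, z, hy, hz, rfl⟩ := h
        have hly := hload _ _ hy
        have hlz := hload _ _ hz
        cases hk : I.kind with
        | plus =>
          refine ⟨fun e he => by simp [add] at he, fun e he => by simp [add] at he, ?_⟩
          rintro τ (hτ | hτ)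
          · exact hly.made τ hτ
          · exact hlz.made τ hτ
        | times =>
          refine ⟨fun e he => by simp [mul] at he, fun e he => by simp [mul] at he, ?_⟩
          intro τ hτ
          exact ⟨p, t, by omega, ⟨y, z, ⟨I, hI, hk, hy, hz⟩, hτ⟩, .refl _ _, hly.nearA _ hτ.1,
            hlz.nearB _ hτ.2⟩
      · rw [Function.update_of_ne hr] at h
        exact hload r x h

/-- The run on provenances ends with a record of `(i,k,j)` at the place of `C(i,j)`; the operands
travelled to `q` and the record travelled from `q`, all within time `T`. -/
lemma exists_makes {LC : Layout n s} {T : ℕ} (h : Program.ComputesWithin.{u} P LA LB LC T)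
    (i k j : Fin n) : ∃ q, ∃ t < T, Makes.{u} P LA LB q t (i, k, j) ∧ Near T q (LA (i, k)) ∧
      Near T q (LB (k, j)) ∧ Near T q (LC (i, j)) := by
  obtain ⟨t, ht, -, hC⟩ := h (Provenance.{u} n) add mul add_assoc (matA n) (matB n)
  obtain ⟨x, hx, hmem⟩ := mem_generalProduct.{u} i k j
  obtain ⟨q, t', ht', h1, h2, h3, h4⟩ :=
    (localized_run t _ _ x ((hC i j).trans hx)).made (i, k, j) hmem
  exact ⟨q, t', by omega, h1, h3.mono ht, h4.mono ht, h2.symm.mono ht⟩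

/-- Within time `T` all scalar products are computed in a cube of edge length `10 T + 1`, so there
are at most `(10 T + 1) ^ 3 * T` of them. -/
lemma cube_le_of_computesWithin {LC : Layout n s} {T : ℕ}
    (h : Program.ComputesWithin.{u} P LA LB LC T) : n ^ 3 ≤ (10 * T + 1) ^ 3 * T := by
  rcases Nat.eq_zero_or_pos n with rfl | hn
  · simp
  choose q t ht hm hA hB hC using exists_makes h
  let o : Fin n := ⟨0, hn⟩
  -- Change one index at a time: `(i,k,j)` and `(i,k,o)` share `A(i,k)`, then `(i,k,o)` and
  -- `(o,k,o)` share `B(k,o)`, and the last one contributes to `C(o,o)`. This makes five distances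
  -- of at most `T`.
  have hnear : ∀ i k j, Near (5 * T) (q i k j) (LC (o, o)) := fun i k j =>
    (((((hA i k j).trans (hA i k o).symm).trans (hB i k o)).trans (hB o k o).symm).trans
      (hC o k o)).mono (by omega)
  classical
  let S : Finset (Proc s) := Finset.univ.filter fun p => Near (5 * T) p (LC (o, o))
  have hcard : (Finset.univ : Finset (Fin n × Fin n × Fin n)).card ≤
      (S ×ˢ Finset.range T).card := by
    -- A pair of processor and time makes only one product, so products inject into such pairs.
    refine Finset.card_le_card_of_injOn (fun τ => (q τ.1 τ.2.1 τ.2.2, t τ.1 τ.2.1 τ.2.2)) ?_ ?_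
    · intro τ _
      simp [S, hnear, ht]
    · intro τ _ τ' _ hτ
      simp only [Prod.mk.injEq] at hτ
      have h1 := hm τ.1 τ.2.1 τ.2.2
      rw [hτ.1, hτ.2] at h1
      exact h1.unique (hm τ'.1 τ'.2.1 τ'.2.2)
  rw [Finset.card_product, Finset.card_range] at hcard
  have hS := card_near_le (LC (o, o)) (5 * T) S fun p hp => by simpa [S] using hp
  have e1 : 2 * (5 * T) + 1 = 10 * T + 1 := by ring
  rw [e1] at hS
  calc n ^ 3 = (Finset.univ : Finset (Fin n × Fin n × Fin n)).card := by simp; ring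
    _ ≤ S.card * T := hcard
    _ ≤ (10 * T + 1) ^ 3 * T := Nat.mul_le_mul_right _ hS

/-- The lower bound for matrix multiplication on the mesh. -/
theorem rpow_le_of_computesWithin {LC : Layout n s} {T : ℕ}
    (h : Program.ComputesWithin.{u} P LA LB LC T) : 1 / 11 * (n : ℝ) ^ (3 / 4 : ℝ) ≤ T := by
  have h0 := cube_le_of_computesWithin h
  -- The estimate `10 T + 1 ≤ 11 T` needs `1 ≤ T`.
  rcases Nat.eq_zero_or_pos T with rfl | hT
  · have : n = 0 := by simpa using h0
    subst this
    norm_num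
  have h1 : n ^ 3 ≤ (11 * T) ^ 4 := by
    calc n ^ 3 ≤ (10 * T + 1) ^ 3 * T := h0
      _ ≤ (11 * T) ^ 3 * (11 * T) := by gcongr <;> omega
      _ = (11 * T) ^ 4 := by ring
  have h2 : (n : ℝ) ^ (3 : ℝ) ≤ (11 * T : ℝ) ^ (4 : ℝ) := by
    have : ((n ^ 3 : ℕ) : ℝ) ≤ ((11 * T) ^ 4 : ℕ) := by exact_mod_cast h1
    push_cast at this
    exact_mod_cast this
  have h3 := Real.rpow_le_rpow (by positivity) h2 (by norm_num : (0 : ℝ) ≤ 1 / 4)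
  rw [← Real.rpow_mul (by positivity), ← Real.rpow_mul (by positivity)] at h3
  norm_num at h3
  linarith

end LowerBound

/-! ### Decomposition of permutations of a grid -/

section Permutation

/-- A bipartite multigraph (edges `e ∈ E` from `f e` to `g e`) that is regular of degree `k` has a
proper colouring of its edges with `k` colours. -/
lemma exists_edge_colouring {ι X : Type*} [Fintype X] [DecidableEq X] [DecidableEq ι] (k : ℕ)
    (E : Finset ι) (f g : ι → X) (hf : ∀ x, (E.filter fun e => f e = x).card = k)
    (hg : ∀ x, (E.filter fun e => g e = x).card = k) :
    ∃ c : ι → ℕ, (∀ e ∈ E, c e < k) ∧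
      ∀ e ∈ E, ∀ e' ∈ E, c e = c e' → (f e = f e' ∨ g e = g e') → e = e' := by
  induction k generalizing E with
  | zero =>
    have hE : ∀ e, e ∉ E := fun e he => by
      have := Finset.card_eq_zero.1 (hf (f e))
      exact Finset.notMem_empty e (this ▸ Finset.mem_filter.2 ⟨he, rfl⟩)
    exact ⟨fun _ => 0, fun e he => (hE e he).elim, fun e he => (hE e he).elim⟩
  | succ k ih =>
    let N : X → Finset X := fun x => (E.filter fun e => f e = x).image g
    -- Hall's condition by double counting: the `k + 1` edges at each vertex of `S` all end in the
    -- neighbourhood of `S`, where each vertex absorbs only `k + 1` edges.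
    obtain ⟨m, hm, hmN⟩ := (Finset.all_card_le_biUnion_card_iff_exists_injective N).1 (by
      intro S
      have h1 : (E.filter fun e => f e ∈ S).card = S.card * (k + 1) := by
        rw [Finset.card_eq_sum_card_fiberwise (f := f) (t := S) (fun e he => by
          simpa using (Finset.mem_filter.1 he).2), ← smul_eq_mul, ← Finset.sum_const]
        refine Finset.sum_congr rfl fun x hx => ?_
        rw [← hf x, Finset.filter_filter]
        congr 1
        refine Finset.filter_congr fun e _ => ⟨fun h => h.2, fun h => ⟨h ▸ hx, h⟩⟩
      have h2 : (E.filter fun e => g e ∈ S.biUnion N).card = (S.biUnion N).card * (k + 1) := by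
        rw [Finset.card_eq_sum_card_fiberwise (f := g) (t := S.biUnion N) (fun e he => by
          simpa using (Finset.mem_filter.1 he).2), ← smul_eq_mul, ← Finset.sum_const]
        refine Finset.sum_congr rfl fun x hx => ?_
        rw [← hg x, Finset.filter_filter]
        congr 1
        refine Finset.filter_congr fun e _ => ⟨fun h => h.2, fun h => ⟨h ▸ hx, h⟩⟩
      have h3 : (E.filter fun e => f e ∈ S) ⊆ E.filter fun e => g e ∈ S.biUnion N := by
        intro e he
        obtain ⟨he, hS⟩ := Finset.mem_filter.1 he
        refine Finset.mem_filter.2 ⟨he, Finset.mem_biUnion.2 ⟨f e, hS, ?_⟩⟩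
        exact Finset.mem_image_of_mem g (Finset.mem_filter.2 ⟨he, rfl⟩)
      have h4 := Finset.card_le_card h3
      rw [h1, h2] at h4
      exact Nat.le_of_mul_le_mul_right h4 k.succ_pos)
    have hmN' : ∀ x, ∃ e ∈ E, f e = x ∧ g e = m x := fun x => by
      obtain ⟨e, he, h⟩ := Finset.mem_image.1 (hmN x)
      exact ⟨e, (Finset.mem_filter.1 he).1, (Finset.mem_filter.1 he).2, h⟩
    choose μ hμE hμf hμg using hmN'
    have hsurj : Function.Surjective m := Finite.injective_iff_surjective.1 hm
    -- The matching is perfect on both sides, so removing its edges lowers every degree by one; the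
    -- matching itself receives the new colour `k`.
    let E' := E.filter fun e => ∀ x, e ≠ μ x
    have hfm : ∀ e, (∃ x, e = μ x) → e = μ (f e) := by
      rintro e ⟨x, rfl⟩
      rw [hμf]
    have hgm : ∀ e e', (∃ x, e = μ x) → (∃ x, e' = μ x) → g e = g e' → e = e' := by
      rintro e e' ⟨x, rfl⟩ ⟨x', rfl⟩ h
      rw [hμg, hμg] at h
      rw [hm h]
    have key : ∀ (h : ι → X), (∀ x, (E.filter fun e => h e = x).card = k + 1) →
        (∀ x, ∃ y, h (μ y) = x) → (∀ y y', h (μ y) = h (μ y') → y = y') →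
        ∀ x, (E'.filter fun e => h e = x).card = k := by
      intro h hh hex hinj x
      obtain ⟨y, hy⟩ := hex x
      have : (E'.filter fun e => h e = x) = (E.filter fun e => h e = x).erase (μ y) := by
        ext e
        simp only [E', Finset.mem_filter, Finset.mem_erase]
        constructor
        · rintro ⟨⟨h1, h2⟩, h3⟩
          exact ⟨h2 y, h1, h3⟩
        · rintro ⟨h1, h2, h3⟩
          refine ⟨⟨h2, fun z hz => h1 ?_⟩, h3⟩
          rw [hz, hinj z y (by rw [← hz, h3, hy])]
      rw [this, Finset.card_erase_of_mem (Finset.mem_filter.2 ⟨hμE y, hy⟩), hh x]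
      rfl
    obtain ⟨c, hc1, hc2⟩ := ih E'
      (key f hf (fun x => ⟨x, hμf x⟩) fun y y' h => by rwa [hμf, hμf] at h)
      (key g hg (fun x => (hsurj x).imp fun y hy => (hμg y).trans hy)
        fun y y' h => hm (by rwa [hμg, hμg] at h))
    classical
    refine ⟨fun e => if ∃ x, e = μ x then k else c e, fun e he => ?_, fun e he e' he' hcc h => ?_⟩
    · dsimp only
      split_ifs with hx
      · omega
      · have := hc1 e (Finset.mem_filter.2 ⟨he, fun x hxe => hx ⟨x, hxe⟩⟩)
        omega
    · dsimp only at hcc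
      have mem : ∀ e ∈ E, (¬ ∃ x, e = μ x) → e ∈ E' := fun e he hx =>
        Finset.mem_filter.2 ⟨he, fun x hxe => hx ⟨x, hxe⟩⟩
      split_ifs at hcc with h1 h2 h2
      · rcases h with h | h
        · rw [hfm e h1, hfm e' h2, h]
        · exact hgm e e' h1 h2 h
      · have := hc1 e' (mem e' he' h2)
        omega
      · have := hc1 e (mem e he h1)
        omega
      · exact hc2 e (mem e he h1) e' (mem e' he' h2) hcc h

/-- A permutation of a grid is the composition of permutations within the columns, within the rows,
and within the columns. -/
lemma exists_three_phase {X Y : Type*} [Finite X] [Finite Y] (π : Equiv.Perm (X × Y)) :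
    ∃ f₁ f₂ f₃ : Equiv.Perm (X × Y), (∀ p, (f₁ p).1 = p.1) ∧ (∀ p, (f₂ p).2 = p.2) ∧
      (∀ p, (f₃ p).1 = p.1) ∧ ∀ p, π p = f₁ (f₂ (f₃ p)) := by
  classical
  have := Fintype.ofFinite X
  have := Fintype.ofFinite Y
  have hfst : ∀ x : X, ((Finset.univ : Finset (X × Y)).filter fun e => e.1 = x).card =
      Fintype.card Y := by
    intro x
    have : ((Finset.univ : Finset (X × Y)).filter fun e => e.1 = x) =
        Finset.univ.image fun y => (x, y) := by
      ext ⟨a, b⟩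
      simp [eq_comm]
    rw [this, Finset.card_image_of_injective _ (fun y y' h => (Prod.mk.inj h).2), Finset.card_univ]
  -- The vertices are the columns, and each `p` is an edge from its column to that of `π p`. The
  -- colour of `p` serves as the row in which it crosses: elements with the same source column, or
  -- with the same target column, get different rows.
  obtain ⟨c, hc1, hc2⟩ := exists_edge_colouring (Fintype.card Y) Finset.univ
    (fun p : X × Y => p.1) (fun p => (π p).1) hfst (fun x => by
      rw [← hfst x]
      refine Finset.card_bij (fun p _ => π p) (fun p hp => by simpa using hp)
        (fun p _ p' _ h => π.injective h) fun p hp => ⟨π.symm p, by simpa using hp, by simp⟩)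
  let col : X × Y → Y := fun p => (Fintype.equivFin Y).symm ⟨c p, hc1 p (Finset.mem_univ p)⟩
  have hcol : ∀ p p', col p = col p' → (p.1 = p'.1 ∨ (π p).1 = (π p').1) → p = p' :=
    fun p p' h => hc2 p (Finset.mem_univ _) p' (Finset.mem_univ _) (by simpa [col] using h)
  -- `e₁` brings every element to its crossing row, and `e₂` records where it is after the crossing;
  -- the phases are `e₁`, then `e₂` after the inverse of `e₁`, then `π` after the inverse of `e₂`.
  let e₁ : Equiv.Perm (X × Y) := Equiv.ofBijective (fun p => (p.1, col p))
    (Finite.injective_iff_bijective.1 fun p p' h =>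
      hcol p p' (Prod.mk.inj h).2 (.inl (Prod.mk.inj h).1))
  let e₂ : Equiv.Perm (X × Y) := Equiv.ofBijective (fun p => ((π p).1, col p))
    (Finite.injective_iff_bijective.1 fun p p' h =>
      hcol p p' (Prod.mk.inj h).2 (.inr (Prod.mk.inj h).1))
  refine ⟨e₂.symm.trans π, e₁.symm.trans e₂, e₁, fun p => ?_, fun p => ?_, fun p => rfl,
    fun p => by simp⟩
  · obtain ⟨q, rfl⟩ := e₂.surjective p
    simp [e₂]
  · obtain ⟨q, rfl⟩ := e₁.surjective p
    simp only [Equiv.trans_apply, Equiv.symm_apply_apply]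
    rfl

/-- The map `f` moves processors along the axis `a` only. -/
def AlongAxis {s : ℕ} (a : Fin 3) (f : Proc s → Proc s) : Prop :=
  ∀ p b, b ≠ a → f p b = p b

/-- The coordinates of a processor. -/
def procEquiv (s : ℕ) : Proc s ≃ (Fin s × Fin s) × Fin s where
  toFun p := ((p 0, p 1), p 2)
  invFun q := ![q.1.1, q.1.2, q.2]
  left_inv p := by funext a; fin_cases a <;> rfl
  right_inv q := rfl

/-- A permutation of the processors is a composition of five maps along axes. -/
lemma exists_five_phase {s : ℕ} (π : Equiv.Perm (Proc s)) :
    ∃ f₁ f₂ f₃ f₄ f₅ : Proc s → Proc s, AlongAxis 2 f₁ ∧ AlongAxis 1 f₂ ∧ AlongAxis 0 f₃ ∧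
      AlongAxis 1 f₄ ∧ AlongAxis 2 f₅ ∧ ∀ p, π p = f₁ (f₂ (f₃ (f₄ (f₅ p)))) := by
  let φ := procEquiv s
  -- First the mesh is regarded as a grid whose columns are the lines along axis 2. The middle phase
  -- then permutes each plane of fixed third coordinate, and each of these permutations is
  -- decomposed once more.
  obtain ⟨g₁, g₂, g₃, h1, h2, h3, h⟩ := exists_three_phase ((φ.symm.trans π).trans φ)
  have hrow : ∀ z : Fin s, ∃ ρ : Equiv.Perm (Fin s × Fin s), ∀ q, ρ q = (g₂ (q, z)).1 := by
    intro z
    refine ⟨Equiv.ofBijective (fun q => (g₂ (q, z)).1)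
      (Finite.injective_iff_bijective.1 fun q q' hq => ?_), fun q => rfl⟩
    have : g₂ (q, z) = g₂ (q', z) := Prod.ext hq (by rw [h2, h2])
    exact (Prod.mk.inj (g₂.injective this)).1
  choose ρ hρ using hrow
  choose k₁ k₂ k₃ e1 e2 e3 e using fun z => exists_three_phase (ρ z)
  let lift : (Fin s → Equiv.Perm (Fin s × Fin s)) → Proc s → Proc s := fun k p =>
    φ.symm (k (p 2) (p 0, p 1), p 2)
  refine ⟨fun p => φ.symm (g₁ (φ p)), lift k₁, lift k₂, lift k₃, fun p => φ.symm (g₃ (φ p)),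
    ?_, ?_, ?_, ?_, ?_, fun p => ?_⟩
  · intro p b hb
    have := h1 (φ p)
    fin_cases b
    · exact congrArg Prod.fst this
    · exact congrArg Prod.snd this
    · exact absurd rfl hb
  · intro p b hb
    have := e1 (p 2) (p 0, p 1)
    fin_cases b
    · exact this
    · exact absurd rfl hb
    · rfl
  · intro p b hb
    have := e2 (p 2) (p 0, p 1)
    fin_cases b
    · exact absurd rfl hb
    · exact this
    · rfl
  · intro p b hb
    have := e3 (p 2) (p 0, p 1)
    fin_cases b
    · exact this
    · exact absurd rfl hb
    · rfl
  · intro p b hb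
    have := h3 (φ p)
    fin_cases b
    · exact congrArg Prod.fst this
    · exact congrArg Prod.snd this
    · exact absurd rfl hb
  · set q := g₃ (φ p) with hq
    have hmid : lift k₁ (lift k₂ (lift k₃ (φ.symm q))) = φ.symm (g₂ q) := by
      change φ.symm (k₁ q.2 (k₂ q.2 (k₃ q.2 q.1)), q.2) = _
      rw [← e, hρ]
      exact congrArg φ.symm (Prod.ext rfl (h2 q).symm)
    have hp := h (φ p)
    simp only [Equiv.trans_apply, Equiv.symm_apply_apply] at hp
    rw [← φ.symm_apply_apply (π p), hp]
    change _ = φ.symm (g₁ (φ (lift k₁ (lift k₂ (lift k₃ (φ.symm q))))))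
    rw [hmid, Equiv.apply_symm_apply]

end Permutation

/-! ### Routing -/

section Routing

variable {s R n d : ℕ}

/-- The processor reached from `p` by `t` moves in direction `e`. -/
def walk (p : Proc s) (e : Dir) : ℕ → Option (Proc s)
  | 0 => some p
  | t + 1 => (nbr p e).bind fun q => walk q e t

lemma walk_down {a : Fin 3} {t : ℕ} {p q : Proc s} (h : ∀ b, b ≠ a → q b = p b)
    (ht : (q a : ℕ) + t = p a) : walk p (a, false) t = some q := by
  induction t generalizing p with
  | zero =>
    refine congrArg some (funext fun b => ?_)
    by_cases hb : b = a
    · subst hb; exact Fin.ext (by omega)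
    · exact (h b hb).symm
  | succ t ih =>
    have : nbr p (a, false) = some (Function.update p a
        ⟨(p a : ℕ) - 1, lt_of_le_of_lt (Nat.sub_le _ _) (p a).isLt⟩) := by
      simp only [nbr, Bool.false_eq_true, if_false]
      rw [if_neg (by omega)]
    rw [walk, this, Option.bind_some]
    refine ih (fun b hb => by rw [Function.update_of_ne hb, h b hb]) ?_
    rw [Function.update_self]
    simp only
    omega

lemma walk_up {a : Fin 3} {t : ℕ} {p q : Proc s} (h : ∀ b, b ≠ a → q b = p b)
    (ht : (p a : ℕ) + t = q a) : walk p (a, true) t = some q := by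
  induction t generalizing p with
  | zero =>
    refine congrArg some (funext fun b => ?_)
    by_cases hb : b = a
    · subst hb; exact Fin.ext (by omega)
    · exact (h b hb).symm
  | succ t ih =>
    have hlt : (p a : ℕ) + 1 < s := by have := (q a).isLt; omega
    have : nbr p (a, true) = some (Function.update p a ⟨(p a : ℕ) + 1, hlt⟩) := by
      simp only [nbr, if_true]
      rw [dif_pos hlt]
    rw [walk, this, Option.bind_some]
    refine ih (fun b hb => by rw [Function.update_of_ne hb, h b hb]) ?_
    rw [Function.update_self]
    simp only
    omega

open Classical in
/-- All processors with the property `M` fetch the content of the register `src` of a processor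
that is at most `l` moves away in the direction `e`. -/
lemma reach_fetch_dir (e : Dir) {src dst tmp : Fin R} (hdt : dst ≠ tmp) (M : Proc s → Prop)
    (G : Proc s → Proc s) (l : ℕ) (σ : TermRegs n s R) :
    Reach d (fun τ => (∀ p, τ p dst =
        if M p ∧ ∃ t ≤ l, walk p e t = some (G p) then σ (G p) src else σ p dst) ∧
      ∀ p r, r ≠ dst → r ≠ tmp → τ p r = σ p r) (l + 1) σ := by
  -- All words shift in step through `tmp`: after `k` moves it holds the word that started `k` moves
  -- away. A processor copies it into `dst` at the moment when its source passes by.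
  let Inv : ℕ → TermRegs n s R → Prop := fun k τ =>
    (∀ p, τ p tmp = (walk p e k).bind fun q => σ q src) ∧
    (∀ p, τ p dst =
      if M p ∧ ∃ t ≤ k, walk p e t = some (G p) then σ (G p) src else σ p dst) ∧
    ∀ p r, r ≠ dst → r ≠ tmp → τ p r = σ p r
  suffices h : Reach d (Inv l) (l * 1 + 1) σ from
    h.weaken (by omega) fun τ hτ => hτ.2
  let g₀ : Proc s → Action R := fun p =>
    { send := fun _ => none
      load := fun r => if r = tmp then .own src
        else if r = dst ∧ M p ∧ p = G p then .own src else .own r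
      op := none }
  refine .step g₀ (.of_op_none fun _ => rfl) (Reach.loop (Inv := Inv) l ?_ ⟨?_, ?_, ?_⟩)
  · rintro k - τ ⟨h1, h2, h3⟩
    let g : Proc s → Action R := fun p =>
      { send := fun _ => some tmp
        load := fun r => if r = tmp then .inbox e
          else if r = dst ∧ M p ∧ walk p e (k + 1) = some (G p) then .inbox e else .own r
        op := none }
    have hrec : ∀ p, receive g τ p e = (walk p e (k + 1)).bind fun q => σ q src := by
      intro p
      simp only [receive, g, walk, Option.bind_some, h1, Option.bind_assoc]
    refine .step g (.of_op_none fun _ => rfl) (.done ⟨fun p => ?_, fun p => ?_, fun p r hd ht => ?_⟩)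
    · rw [termStep, execStep_of_op_none rfl]
      simp [loadRegs, g, hrec]
    · rw [termStep, execStep_of_op_none rfl]
      by_cases hM : M p ∧ walk p e (k + 1) = some (G p)
      · have : ∃ t ≤ k + 1, walk p e t = some (G p) := ⟨k + 1, le_rfl, hM.2⟩
        rw [if_pos ⟨hM.1, this⟩]
        simp only [loadRegs, g, hdt, if_false, hM, and_self, if_true]
        rw [hrec, hM.2]
        rfl
      · have : (M p ∧ ∃ t ≤ k + 1, walk p e t = some (G p)) ↔
            (M p ∧ ∃ t ≤ k, walk p e t = some (G p)) := by
          constructor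
          · rintro ⟨hm, t, ht, hw⟩
            refine ⟨hm, t, ?_, hw⟩
            rcases Nat.lt_or_ge k t with h | h
            · obtain rfl : t = k + 1 := by omega
              exact (hM ⟨hm, hw⟩).elim
            · exact h
          · rintro ⟨hm, t, ht, hw⟩
            exact ⟨hm, t, by omega, hw⟩
        simp only [this]
        rw [← h2]
        simp [loadRegs, g, hdt, hM]
    · rw [termStep, execStep_of_op_none rfl, ← h3 p r hd ht]
      simp [loadRegs, g, hd, ht]
  · intro p
    rw [termStep, execStep_of_op_none rfl]
    simp [loadRegs, g₀, walk]
  · intro p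
    rw [termStep, execStep_of_op_none rfl]
    simp only [Nat.le_zero, exists_eq_left, walk, Option.some.injEq]
    by_cases hM : M p ∧ p = G p
    · simp only [loadRegs, g₀, hdt, if_false, hM.1, hM.2.symm, and_self, if_true]
    · simp [loadRegs, g₀, hdt, hM]
  · intro p r hd ht
    rw [termStep, execStep_of_op_none rfl]
    simp [loadRegs, g₀, hd, ht]

/-- All processors with the property `M` fetch the content of the register `src` of a processor
that is at most `l` moves away along the axis `a`. -/
lemma reach_fetch (a : Fin 3) {src dst tmp : Fin R} (hsd : src ≠ dst) (hst : src ≠ tmp)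
    (hdt : dst ≠ tmp) (M : Proc s → Prop) (G : Proc s → Proc s) (l : ℕ)
    (hG : ∀ p, M p → (∀ b, b ≠ a → G p b = p b) ∧ (G p a : ℕ) ≤ p a + l ∧ (p a : ℕ) ≤ G p a + l)
    (σ : TermRegs n s R) :
    Reach d (fun τ => (∀ p, M p → τ p dst = σ (G p) src) ∧ (∀ p, ¬ M p → τ p dst = σ p dst) ∧
      ∀ p r, r ≠ dst → r ≠ tmp → τ p r = σ p r) (2 * l + 2) σ := by
  -- One pass in each direction, with `src` intact in between. Processors pull words instead of
  -- pushing them, so `G` need not be injective and the same routine also broadcasts.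
  refine ((reach_fetch_dir (a, false) (src := src) hdt M G l σ).bind fun τ hτ =>
    (reach_fetch_dir (a, true) (src := src) hdt M G l τ).weaken le_rfl fun ρ hρ => ?_).weaken
    (by omega : l + 1 + (l + 1) ≤ 2 * l + 2) fun _ h => h
  refine ⟨fun p hp => ?_, fun p hp => ?_, fun p r hd ht => ?_⟩
  · rw [hρ.1, hτ.2 _ _ hsd hst]
    split_ifs with h
    · rfl
    · obtain ⟨h1, h2, h3⟩ := hG p hp
      rw [hτ.1, if_pos]
      refine ⟨hp, p a - G p a, by omega, walk_down h1 ?_⟩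
      by_contra hlt
      exact h ⟨hp, G p a - p a, by omega, walk_up h1 (by omega)⟩
  · rw [hρ.1, if_neg (fun h => hp h.1), hτ.1, if_neg (fun h => hp h.1)]
  · rw [hρ.2 p r hd ht, hτ.2 p r hd ht]

/-- A permutation of the contents of a register; the result is kept by the processors with the
property `M`. -/
lemma reach_permute (π : Equiv.Perm (Proc s)) {src dst x y tmp : Fin R}
    (hr : [src, dst, x, y, tmp].Nodup) (M : Proc s → Prop) (σ : TermRegs n s R) :
    Reach d (fun τ => (∀ p, M p → τ p dst = σ (π p) src) ∧ (∀ p, ¬ M p → τ p dst = σ p dst) ∧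
      ∀ p r, r ∉ [dst, x, y, tmp] → τ p r = σ p r) (10 * s + 10) σ := by
  obtain ⟨f₁, f₂, f₃, f₄, f₅, h1, h2, h3, h4, h5, hπ⟩ := exists_five_phase π
  have hG : ∀ (a : Fin 3) (f : Proc s → Proc s) (N : Proc s → Prop), AlongAxis a f → ∀ p, N p →
      (∀ b, b ≠ a → f p b = p b) ∧ (f p a : ℕ) ≤ p a + s ∧ (p a : ℕ) ≤ f p a + s :=
    fun a f N h p _ => ⟨fun b hb => h p b hb, by omega, by omega⟩
  simp only [List.nodup_cons, List.mem_cons, List.not_mem_nil, or_false, not_or] at hr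
  obtain ⟨⟨n1, n2, n3, n4⟩, ⟨n5, n6, n7⟩, ⟨n8, n9⟩, n10, -⟩ := hr
  -- Fetching composes contravariantly, so `f₁` comes first; `x` and `y` alternate as intermediate
  -- registers.
  refine ((reach_fetch 2 n2 n4 n9 (fun _ => True) f₁ s (hG _ _ _ h1) σ).bind fun σ₁ e1 =>
    (reach_fetch 1 n8 n9 n10 (fun _ => True) f₂ s (hG _ _ _ h2) σ₁).bind fun σ₂ e2 =>
    (reach_fetch 0 (Ne.symm n8) n10 n9 (fun _ => True) f₃ s (hG _ _ _ h3) σ₂).bind fun σ₃ e3 =>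
    (reach_fetch 1 n8 n9 n10 (fun _ => True) f₄ s (hG _ _ _ h4) σ₃).bind fun σ₄ e4 =>
    (reach_fetch 2 (Ne.symm n6) n10 n7 M f₅ s (hG _ _ _ h5) σ₄).weaken le_rfl
      fun σ₅ e5 => ?_).weaken (by omega) fun _ h => h
  refine ⟨fun p hp => ?_, fun p hp => ?_, fun p r hr => ?_⟩
  · rw [e5.1 p hp, e4.1 _ trivial, e3.1 _ trivial, e2.1 _ trivial, e1.1 _ trivial, ← hπ]
  · rw [e5.2.1 p hp, e4.2.2 _ _ n6 n7, e3.2.2 _ _ n5 n7, e2.2.2 _ _ n6 n7, e1.2.2 _ _ n5 n7]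
  · simp only [List.mem_cons, List.not_mem_nil, or_false, not_or] at hr
    obtain ⟨m1, m2, m3, m4⟩ := hr
    rw [e5.2.2 _ _ m1 m4, e4.2.2 _ _ m3 m4, e3.2.2 _ _ m2 m4, e2.2.2 _ _ m3 m4, e1.2.2 _ _ m2 m4]

/-- A step in which every processor performs a local operation (possibly none). -/
lemma reach_op (op : Proc s → Option (Instr R)) {σ : TermRegs n s R}
    (hop : StepAllowed d (fun p => ⟨fun _ => none, .own, op p⟩) σ) :
    Reach d (fun τ => ∀ p, τ p = match op p with
      | none => σ p
      | some I => Function.update (σ p) I.dest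
          (Option.map₂ (I.kind.fn Term.plus Term.times) (σ p I.left) (σ p I.right))) 1 σ :=
  .step _ hop (.done fun _ => rfl)

end Routing

/-! ### Blocks of index ranges -/

section Blocks

/-- The first element of the part with number `K` if `0, …, N - 1` is divided into `D` parts. -/
def blockStart (D N K : ℕ) : ℕ := (K * N + (D - 1)) / D

variable {D N K K' x d : ℕ}

/-- `blockStart D N K` is `K * N / D` rounded up; the adjunction of ceiling and floor makes these
numbers the exact boundaries of the parts defined by `part`. -/
lemma blockStart_le_iff (hD : 0 < D) (hN : 0 < N) : blockStart D N K ≤ x ↔ K ≤ D * x / N := by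
  rw [blockStart, Nat.le_div_iff_mul_le hN, ← Nat.lt_succ_iff, Nat.div_lt_iff_lt_mul hD]
  constructor <;> intro h <;> nlinarith [Nat.sub_add_cancel hD]

lemma lt_blockStart_iff (hD : 0 < D) (hN : 0 < N) : x < blockStart D N K ↔ D * x / N < K := by
  rw [← not_le, blockStart_le_iff hD hN, not_le]

lemma blockStart_zero : blockStart D N 0 = 0 := by
  rcases Nat.eq_zero_or_pos D with rfl | hD
  · simp [blockStart]
  · simp [blockStart, hD]

lemma blockStart_self (hD : 0 < D) : blockStart D N D = N := by
  rw [blockStart, Nat.mul_add_div hD, Nat.div_eq_of_lt (by omega), add_zero]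

lemma blockStart_mono (h : K ≤ K') : blockStart D N K ≤ blockStart D N K' :=
  Nat.div_le_div_right (by gcongr)

lemma blockStart_add_div_le : blockStart D N K + N / D ≤ blockStart D N (K + 1) := by
  unfold blockStart
  refine le_trans Nat.div_add_div_le_add_div (Nat.div_le_div_right ?_)
  ring_nf
  omega

/-- The rounding error of `c` consecutive parts together is at most 1 and does not grow with `c`. -/
lemma blockStart_add_le (hD : 0 < D) (c : ℕ) :
    blockStart D N (K + c) ≤ blockStart D N K + c * N / D + 1 := by
  unfold blockStart
  rw [← Nat.lt_succ_iff, Nat.div_lt_iff_lt_mul hD]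
  have h1 := Nat.div_add_mod (K * N + (D - 1)) D
  have h2 := Nat.div_add_mod (c * N) D
  have h3 := Nat.mod_lt (K * N + (D - 1)) hD
  have h4 := Nat.mod_lt (c * N) hD
  generalize (K * N + (D - 1)) / D = q at *
  generalize (c * N) / D = q' at *
  have : (q + q' + 1).succ * D = D * q + D * q' + 2 * D := by simp only [Nat.succ_eq_add_one]; ring
  rw [this, add_mul]
  omega

lemma blockStart_lt_succ (hD : 0 < D) (h : D ≤ N) : blockStart D N K < blockStart D N (K + 1) := by
  have := blockStart_add_div_le (D := D) (N := N) (K := K)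
  have := Nat.div_pos h hD
  omega

lemma part_eq_iff (hN : 0 < N) :
    part N d x = K ↔ blockStart (2 ^ d) N K ≤ x ∧ x < blockStart (2 ^ d) N (K + 1) := by
  rw [blockStart_le_iff (by positivity) hN, lt_blockStart_iff (by positivity) hN, part]
  omega

lemma part_lt (hx : x < N) : part N d x < 2 ^ d := by
  rw [part, Nat.div_lt_iff_lt_mul (by omega)]
  exact Nat.mul_lt_mul_of_pos_left hx (by positivity)

/-- The halvings are nested: the number of a part at level `r` consists of the leading binary digits
of its number at level `d`. -/
lemma part_of_le {r : ℕ} (hr : r ≤ d) : part N r x = part N d x / 2 ^ (d - r) := by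
  obtain ⟨e, rfl⟩ := Nat.exists_eq_add_of_le hr
  rw [part, part, Nat.div_div_eq_div_mul, Nat.add_sub_cancel_left, pow_add,
    mul_comm (2 ^ r) (2 ^ e), mul_comm N, mul_assoc, Nat.mul_div_mul_left _ _ (by positivity)]

end Blocks

/-! ### The subcubes -/

section Subcubes

variable {s d : ℕ}

/-- The edge length of the part of a subcube that is used, after `d` halvings. -/
def subEdge (s d : ℕ) : ℕ := s / 2 ^ d

/-- The number of the subcube of `p` on the axis `a`. -/
def blk (d : ℕ) (p : Proc s) (a : Fin 3) : ℕ := part s d (p a)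

/-- The coordinate of `p` on the axis `a` within its subcube. -/
def loc (d : ℕ) (p : Proc s) (a : Fin 3) : ℕ := p a - blockStart (2 ^ d) s (blk d p a)

/-- The processor with the coordinate `x` within the subcube `K` on the axis `a`, and the other
coordinates as for `p`. -/
def place (d : ℕ) (p : Proc s) (a : Fin 3) (K x : ℕ) : Proc s :=
  -- The default `p` does not occur for `K < 2 ^ d` and `x < subEdge s d`.
  if h : blockStart (2 ^ d) s K + x < s then Function.update p a ⟨_, h⟩ else p

/-- The processor with coordinate `x` on the axis `a` in the subcube of `p`. -/
def setLoc (d : ℕ) (p : Proc s) (a : Fin 3) (x : ℕ) : Proc s := place d p a (blk d p a) x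

lemma pos_of_proc (p : Proc s) : 0 < s := (p 0).pos

lemma blk_lt (p : Proc s) (a : Fin 3) : blk d p a < 2 ^ d := part_lt (p a).isLt

lemma blockStart_add_loc (p : Proc s) (a : Fin 3) :
    blockStart (2 ^ d) s (blk d p a) + loc d p a = p a :=
  Nat.add_sub_cancel' ((part_eq_iff (pos_of_proc p)).1 rfl).1

lemma blockStart_add_lt {K x : ℕ} (hK : K < 2 ^ d) (hx : x < subEdge s d) :
    blockStart (2 ^ d) s K + x < s := by
  have h1 := blockStart_add_div_le (D := 2 ^ d) (N := s) (K := K)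
  have h2 := blockStart_mono (D := 2 ^ d) (N := s) (show K + 1 ≤ 2 ^ d from hK)
  rw [blockStart_self (by positivity)] at h2
  unfold subEdge at hx
  omega

lemma place_self (p : Proc s) {a : Fin 3} {K x : ℕ} (hK : K < 2 ^ d) (hx : x < subEdge s d) :
    (place d p a K x a : ℕ) = blockStart (2 ^ d) s K + x := by
  rw [place, dif_pos (blockStart_add_lt hK hx), Function.update_self]

lemma place_of_ne (p : Proc s) {a b : Fin 3} (K x : ℕ) (h : b ≠ a) : place d p a K x b = p b := by
  unfold place
  split_ifs
  · exact Function.update_of_ne h _ _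
  · rfl

lemma blk_place_self (p : Proc s) {a : Fin 3} {K x : ℕ} (hK : K < 2 ^ d) (hx : x < subEdge s d) :
    blk d (place d p a K x) a = K := by
  rw [blk, part_eq_iff (pos_of_proc p), place_self p hK hx]
  have := blockStart_add_div_le (D := 2 ^ d) (N := s) (K := K)
  unfold subEdge at hx
  omega

lemma loc_place_self (p : Proc s) {a : Fin 3} {K x : ℕ} (hK : K < 2 ^ d) (hx : x < subEdge s d) :
    loc d (place d p a K x) a = x := by
  rw [loc, blk_place_self p hK hx, place_self p hK hx, Nat.add_sub_cancel_left]

lemma blk_place_of_ne (p : Proc s) {a b : Fin 3} (K x : ℕ) (h : b ≠ a) :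
    blk d (place d p a K x) b = blk d p b := by
  rw [blk, place_of_ne p K x h, blk]

lemma loc_place_of_ne (p : Proc s) {a b : Fin 3} (K x : ℕ) (h : b ≠ a) :
    loc d (place d p a K x) b = loc d p b := by
  rw [loc, blk_place_of_ne p K x h, place_of_ne p K x h, loc]

lemma loc_setLoc_self (p : Proc s) {a : Fin 3} {x : ℕ} (hx : x < subEdge s d) :
    loc d (setLoc d p a x) a = x := loc_place_self p (blk_lt p a) hx

lemma loc_setLoc_of_ne (p : Proc s) {a b : Fin 3} (x : ℕ) (h : b ≠ a) :
    loc d (setLoc d p a x) b = loc d p b := loc_place_of_ne p _ x h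

lemma blk_setLoc (p : Proc s) (a b : Fin 3) {x : ℕ} (hx : x < subEdge s d) :
    blk d (setLoc d p a x) b = blk d p b := by
  by_cases h : b = a
  · subst h; exact blk_place_self p (blk_lt p b) hx
  · exact blk_place_of_ne p _ x h

lemma proc_ext {p q : Proc s} (h : ∀ a, blk d p a = blk d q a) (h' : ∀ a, loc d p a = loc d q a) :
    p = q := by
  funext a
  ext
  rw [← blockStart_add_loc (d := d) p a, ← blockStart_add_loc (d := d) q a, h, h']

lemma setLoc_loc (p : Proc s) (a : Fin 3) (h : loc d p a < subEdge s d) :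
    setLoc d p a (loc d p a) = p := by
  refine proc_ext (d := d) (fun b => blk_setLoc p a b h) fun b => ?_
  by_cases hb : b = a
  · subst hb; exact loc_setLoc_self p h
  · exact loc_setLoc_of_ne p _ hb

lemma setLoc_setLoc (p : Proc s) (a : Fin 3) {x y : ℕ} (hx : x < subEdge s d)
    (hy : y < subEdge s d) : setLoc d (setLoc d p a x) a y = setLoc d p a y := by
  refine proc_ext (d := d) (fun b => ?_) fun b => ?_
  · rw [blk_setLoc _ a b hy, blk_setLoc _ a b hx, blk_setLoc _ a b hy]
  · by_cases hb : b = a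
    · subst hb; rw [loc_setLoc_self _ hy, loc_setLoc_self _ hy]
    · rw [loc_setLoc_of_ne _ _ hb, loc_setLoc_of_ne _ _ hb, loc_setLoc_of_ne _ _ hb]

lemma nbr_up_eq_setLoc (p : Proc s) (a : Fin 3) (h : loc d p a + 1 < subEdge s d) :
    nbr p (a, true) = some (setLoc d p a (loc d p a + 1)) := by
  have h1 : (setLoc d p a (loc d p a + 1) a : ℕ) = _ := place_self p (blk_lt p a) h
  have h2 := blockStart_add_loc (d := d) p a
  have := walk_up (t := 1) (p := p) (q := setLoc d p a (loc d p a + 1)) (a := a)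
    (fun b hb => place_of_ne p _ _ hb) (by omega)
  simpa [walk] using this

lemma nbr_down_eq_setLoc (p : Proc s) (a : Fin 3) (h : loc d p a < subEdge s d)
    (h0 : loc d p a ≠ 0) : nbr p (a, false) = some (setLoc d p a (loc d p a - 1)) := by
  have h1 : (setLoc d p a (loc d p a - 1) a : ℕ) = _ := place_self p (blk_lt p a) (by omega)
  have h2 := blockStart_add_loc (d := d) p a
  have := walk_down (t := 1) (p := p) (q := setLoc d p a (loc d p a - 1)) (a := a)
    (fun b hb => place_of_ne p _ _ hb) (by omega)
  simpa [walk] using this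

end Subcubes

/-! ### Matrix multiplication in a layer of a subcube -/

section Layer

variable {s R n d : ℕ}

/-- The contents of the register `top` in a row of the axis `a` of a subcube move down to the end
of the row, and from there up again in the register `bot`; the row starts with a delay that is its
coordinate on the axis `b`. This is the state after `t` steps, the initial content being given by
`f`. -/
structure Conveyor (d : ℕ) (a b : Fin 3) (top bot : Fin R) (f : Proc s → Option (Term n))
    (t : ℕ) (τ : TermRegs n s R) : Prop where
  -- The truncated subtraction expresses the delay: nothing moves during the first `loc d p b`
  -- steps.
  top : ∀ p k, loc d p a < subEdge s d → loc d p b < subEdge s d → k < subEdge s d →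
    loc d p a + (t - loc d p b) = k → τ p top = f (setLoc d p a k)
  -- Word `k` waits `loc d p b` steps, needs `k` steps down to the end, one to turn round, and `loc
  -- d p a` steps up. This sum is symmetric in `a` and `b`, so a row of `A` and a column of `B` meet
  -- with equal index `k` everywhere.
  bot : ∀ p k, loc d p a < subEdge s d → loc d p b < subEdge s d → k < subEdge s d →
    1 + loc d p b + loc d p a + k = t → τ p bot = f (setLoc d p a k)

lemma Conveyor.zero {a b : Fin 3} {top bot : Fin R} (τ : TermRegs n s R) :
    Conveyor d a b top bot (fun p => τ p top) 0 τ where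
  top p k h1 h2 h3 h4 := by
    obtain rfl : k = loc d p a := by omega
    rw [setLoc_loc p a h1]
  bot p k h1 h2 h3 h4 := by omega

lemma Conveyor.congr {a b : Fin 3} {top bot : Fin R} {f : Proc s → Option (Term n)} {t : ℕ}
    {τ τ' : TermRegs n s R} (h : Conveyor d a b top bot f t τ) (ht : ∀ p, τ' p top = τ p top)
    (hb : ∀ p, τ' p bot = τ p bot) : Conveyor d a b top bot f t τ' where
  top p k h1 h2 h3 h4 := (ht p).trans (h.top p k h1 h2 h3 h4)
  bot p k h1 h2 h3 h4 := (hb p).trans (h.bot p k h1 h2 h3 h4)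

lemma Conveyor.succ {a b : Fin 3} (hab : b ≠ a) {top bot : Fin R} {f : Proc s → Option (Term n)}
    {t : ℕ} {τ : TermRegs n s R} (h : Conveyor d a b top bot f t τ) {g : Proc s → Action R}
    (htop : ∀ p, (g p).load top = if loc d p b ≤ t then .inbox (a, true) else .own top)
    (hbot : ∀ p, (g p).load bot = if loc d p a = 0 then .own top else .inbox (a, false))
    (hdown : ∀ p, (g p).send (a, false) = some top)
    (hup : ∀ p, (g p).send (a, true) = some bot) :
    Conveyor d a b top bot f (t + 1) (loadRegs g τ) where
  top p k h1 h2 h3 h4 := by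
    unfold loadRegs
    rw [htop]
    by_cases ht : loc d p b ≤ t
    · have h5 : loc d p a + 1 < subEdge s d := by omega
      simp only [ht, if_true, receive, nbr_up_eq_setLoc p a h5, Option.bind_some]
      change ((g _).send (a, false)).bind _ = _
      rw [hdown, Option.bind_some, h.top _ k, setLoc_setLoc p a h5 h3]
      · rw [loc_setLoc_self p h5]; exact h5
      · rw [loc_setLoc_of_ne p _ hab]; exact h2
      · exact h3
      · rw [loc_setLoc_self p h5, loc_setLoc_of_ne p _ hab]; omega
    · simp only [ht, if_false]
      exact h.top p k h1 h2 h3 (by omega)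
  bot p k h1 h2 h3 h4 := by
    unfold loadRegs
    rw [hbot]
    by_cases h0 : loc d p a = 0
    · simp only [h0, if_true]
      exact h.top p k h1 h2 h3 (by omega)
    · have h5 : loc d p a - 1 < subEdge s d := by omega
      simp only [h0, if_false, receive, nbr_down_eq_setLoc p a h1 h0, Option.bind_some]
      change ((g _).send (a, true)).bind _ = _
      rw [hup, Option.bind_some, h.bot _ k, setLoc_setLoc p a h5 h3]
      · rw [loc_setLoc_self p h5]; exact h5
      · rw [loc_setLoc_of_ne p _ hab]; exact h2
      · exact h3
      · rw [loc_setLoc_self p h5, loc_setLoc_of_ne p _ hab]; omega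

/-- The register `acc` of `p` contains the sum for `C(i,j)` from `lo` to `hi`, unless this range
is empty. -/
def Holds (i j : Fin n) (lo hi : ℕ) (c : Option (Term n)) : Prop :=
  lo < hi → ∃ u, c = some u ∧ PartialSum i j lo hi u

/-- In every layer, rows of `A` and columns of `B` (in the registers `aTop` and `bTop`) are
multiplied and the results are added to the partial sums in the register `acc`, at the processors
with the property `V`. -/
lemma reach_layer_product {aTop aBot bTop bBot pr acc : Fin R}
    (hr : [aTop, aBot, bTop, bBot, pr, acc].Nodup) (V : Proc s → Prop) (i j : Proc s → Fin n)
    (lo base len : Proc s → ℕ) (σ : TermRegs n s R)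
    (hlen : ∀ p, V p → len p ≤ subEdge s d ∧ loc d p 0 < subEdge s d ∧ loc d p 1 < subEdge s d)
    (hlo : ∀ p, V p → lo p ≤ base p) (hbase : ∀ p, V p → base p + len p ≤ n)
    (hA : ∀ p, V p → ∀ (k : Fin n) l, l < len p → (k : ℕ) = base p + l →
      σ (setLoc d p 1 l) aTop = some (.entryA (i p) k))
    (hB : ∀ p, V p → ∀ (k : Fin n) l, l < len p → (k : ℕ) = base p + l →
      σ (setLoc d p 0 l) bTop = some (.entryB k (j p)))
    (hacc : ∀ p, V p → Holds (i p) (j p) (lo p) (base p) (σ p acc))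
    (hsub : ∀ p, V p → ∀ k : Fin n, lo p ≤ k → (k : ℕ) < base p + len p →
      InSubcube d p (i p) k (j p)) :
    Reach d (fun τ => (∀ p, V p → Holds (i p) (j p) (lo p) (base p + len p) (τ p acc)) ∧
      ∀ p r, r ∉ [aTop, aBot, bTop, bBot, pr, acc] → τ p r = σ p r) (3 * subEdge s d * 2) σ := by
  simp only [List.nodup_cons, List.mem_cons, List.not_mem_nil, or_false, not_or] at hr
  obtain ⟨⟨n1, n2, n3, n4, n5⟩, ⟨n6, n7, n8, n9⟩, ⟨n10, n11, n12⟩, ⟨n13, n14⟩, n15, -⟩ := hr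
  -- Conveyors for `A` along axis 1 and for `B` along axis 0. After `t` rounds `p` has taken in the
  -- summands that have passed, at most `len p`; `3 * subEdge s d` rounds cover both coordinates and
  -- the length.
  let Inv : ℕ → TermRegs n s R → Prop := fun t τ =>
    Conveyor d 1 0 aTop aBot (fun p => σ p aTop) t τ ∧
    Conveyor d 0 1 bTop bBot (fun p => σ p bTop) t τ ∧
    (∀ p, V p → Holds (i p) (j p) (lo p) (base p + min (len p) (t - loc d p 0 - loc d p 1)) (τ p acc)) ∧
    ∀ p r, r ∉ [aTop, aBot, bTop, bBot, pr, acc] → τ p r = σ p r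
  have hfin := Reach.loop (d := d) (T := 2) (σ := σ) (Inv := Inv) (3 * subEdge s d) ?_
    ⟨Conveyor.zero σ, Conveyor.zero σ, fun p hp => by simpa using hacc p hp, fun _ _ _ => rfl⟩
  · refine hfin.weaken le_rfl fun τ hτ => ⟨fun p hp => ?_, hτ.2.2.2⟩
    have := hτ.2.2.1 p hp
    have h1 := hlen p hp
    rwa [show min (len p) (3 * subEdge s d - loc d p 0 - loc d p 1) = len p by omega] at this
  rintro t - τ ⟨hcA, hcB, hτ, hrest⟩
  let on : Proc s → Prop := fun p =>
    V p ∧ loc d p 0 + loc d p 1 ≤ t ∧ t - loc d p 0 - loc d p 1 < len p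
  -- Since `⊕` has no identity, the first product of a sum is copied into `acc` instead of being
  -- added.
  let first : Proc s → Prop := fun p => lo p = base p + (t - loc d p 0 - loc d p 1)
  classical
  let g : Proc s → Action R := fun p =>
    { send := fun e => if e.1 = 1 then (if e.2 then some aBot else some aTop)
        else (if e.2 then some bBot else some bTop)
      load := fun r =>
        if r = aTop then (if loc d p 0 ≤ t then .inbox (1, true) else .own aTop)
        else if r = aBot then (if loc d p 1 = 0 then .own aTop else .inbox (1, false))
        else if r = bTop then (if loc d p 1 ≤ t then .inbox (0, true) else .own bTop)
        else if r = bBot then (if loc d p 0 = 0 then .own bTop else .inbox (0, false))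
        else .own r
      op := if on p then some ⟨.times, aBot, bBot, pr⟩ else none }
  let g' : Proc s → Action R := fun p =>
    { send := fun _ => none
      load := fun r => if r = acc ∧ on p ∧ first p then .own pr else .own r
      op := if on p ∧ ¬ first p then some ⟨.plus, acc, pr, acc⟩ else none }
  have hA' : Conveyor d 1 0 aTop aBot (fun p => σ p aTop) (t + 1) (loadRegs g τ) :=
    hcA.succ (by decide) (fun p => by simp [g]) (fun p => by simp [g, Ne.symm n1])
      (fun p => by simp [g]) (fun p => by simp [g])
  have hB' : Conveyor d 0 1 bTop bBot (fun p => σ p bTop) (t + 1) (loadRegs g τ) :=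
    hcB.succ (by decide) (fun p => by simp [g, Ne.symm n2, Ne.symm n6])
      (fun p => by simp [g, Ne.symm n3, Ne.symm n7, Ne.symm n10])
      (fun p => by simp [g]) (fun p => by simp [g])
  have hkey : ∀ p, on p → ∃ k : Fin n, (k : ℕ) = base p + (t - loc d p 0 - loc d p 1) ∧
      loadRegs g τ p aBot = some (.entryA (i p) k) ∧ loadRegs g τ p bBot = some (.entryB k (j p)) := by
    rintro p ⟨h0, h1, h2⟩
    have h3 := hlen p h0
    have h4 := hbase p h0
    refine ⟨⟨base p + (t - loc d p 0 - loc d p 1), by omega⟩, rfl, ?_, ?_⟩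
    · rw [hA'.bot p (t - loc d p 0 - loc d p 1) h3.2.2 h3.2.1 (by omega) (by omega)]
      exact hA p h0 _ _ h2 rfl
    · rw [hB'.bot p (t - loc d p 0 - loc d p 1) h3.2.1 h3.2.2 (by omega) (by omega)]
      exact hB p h0 _ _ h2 rfl
  -- the state after the first of the two steps
  obtain ⟨ρ, hρ⟩ : ∃ ρ, ρ = termStep g τ := ⟨_, rfl⟩
  have hρ_of_ne : ∀ p r, r ≠ pr → ρ p r = loadRegs g τ p r := by
    intro p r hr
    by_cases h : on p <;> simp [hρ, execStep, g, h, Function.update_of_ne hr]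
  have hρ_pr : ∀ p, on p → ∃ k : Fin n, (k : ℕ) = base p + (t - loc d p 0 - loc d p 1) ∧
      ρ p pr = some (.times (.entryA (i p) k) (.entryB k (j p))) := by
    intro p hp
    obtain ⟨k, hk, ha, hb⟩ := hkey p hp
    refine ⟨k, hk, ?_⟩
    have : ρ p pr = Option.map₂ Term.times (loadRegs g τ p aBot) (loadRegs g τ p bBot) := by
      simp only [hρ, execStep, g, hp, if_true, Function.update_self]
      rfl
    rw [this, ha, hb]
    rfl
  have hρ_other : ∀ p r, r ∉ [aTop, aBot, bTop, bBot, pr] → ρ p r = τ p r := by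
    intro p r hr
    simp only [List.mem_cons, List.not_mem_nil, or_false, not_or] at hr
    rw [hρ_of_ne p r hr.2.2.2.2]
    simp [loadRegs, g, hr]
  have hρ_acc : ∀ p, ρ p acc = τ p acc := fun p => hρ_other p acc (by
    simp [Ne.symm n5, Ne.symm n9, Ne.symm n12, Ne.symm n14, Ne.symm n15])
  have hg' : ∀ p r, r ≠ acc → termStep g' ρ p r = ρ p r := by
    intro p r hr
    by_cases hp : on p ∧ ¬ first p
    · simp [execStep, loadRegs, g', hp, hr]
    · rw [termStep, execStep_of_op_none (if_neg hp)]
      simp [loadRegs, g', hr]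
  refine .step g ?_ (hρ ▸ .step g' ?_ (.done ⟨?_, ?_, ?_, ?_⟩))
  · intro p I u v hI hu hv
    by_cases hp : on p
    · obtain ⟨k, hk, ha, hb⟩ := hkey p hp
      have h1 := hp.2.2
      simp only [g, hp, if_true, Option.some.injEq] at hI
      subst hI
      refine ⟨fun _ => ⟨i p, k, j p, ?_, ?_, ?_⟩, fun h => nomatch h⟩
      · exact Option.some.inj (hu.symm.trans ha)
      · exact Option.some.inj (hv.symm.trans hb)
      · have := hlo p hp.1
        exact hsub p hp.1 k (by omega) (by omega)
    · simp [g, hp] at hI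
  · intro p I u v hI hu hv
    by_cases hp : on p ∧ ¬ first p
    · obtain ⟨k, hk, hpr⟩ := hρ_pr p hp.1
      have h1 := hp.1.2.2
      have h2 := hlo p hp.1.1
      have h3 : lo p < base p + (t - loc d p 0 - loc d p 1) := by
        have := hp.2
        simp only [first] at this
        omega
      have h4 := hτ p hp.1.1
      rw [show min (len p) (t - loc d p 0 - loc d p 1) = t - loc d p 0 - loc d p 1 by omega] at h4
      obtain ⟨w, hw, hs⟩ := h4 h3
      simp only [g', hp, if_true, not_false_eq_true, and_self, Option.some.injEq] at hI
      subst hI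
      have e1 : loadRegs g' ρ p acc = ρ p acc := by simp [loadRegs, g', hp.2]
      have e2 : loadRegs g' ρ p pr = ρ p pr := by simp [loadRegs, g', n15]
      rw [e1, hρ_acc, hw] at hu
      rw [e2, hpr] at hv
      cases hu
      cases hv
      refine ⟨(fun h => nomatch h), fun _ => ⟨i p, j p, lo p, k, k + 1, ?_, .single k, .inl ?_⟩⟩
      · rw [hk]; exact hs
      · rintro k' ⟨h5, h6⟩
        exact hsub p hp.1.1 k' h5 (by omega)
    · have : (g' p).op = none := if_neg hp
      rw [this] at hI
      cases hI
  · refine hA'.congr (fun p => ?_) (fun p => ?_)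
    · rw [← hρ_of_ne p aTop n4, hg' p aTop n5]
    · rw [← hρ_of_ne p aBot n8, hg' p aBot n9]
  · refine hB'.congr (fun p => ?_) (fun p => ?_)
    · rw [← hρ_of_ne p bTop n11, hg' p bTop n12]
    · rw [← hρ_of_ne p bBot n13, hg' p bBot n14]
  · intro p hV
    by_cases hp : on p
    · obtain ⟨k, hk, hpr⟩ := hρ_pr p hp
      have h1 := hp.2.1
      have h2 := hp.2.2
      have e3 : base p + min (len p) (t + 1 - loc d p 0 - loc d p 1) = k + 1 := by omega
      rw [e3]
      intro hlt
      by_cases hf : first p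
      · refine ⟨.times (.entryA (i p) k) (.entryB k (j p)), ?_, ?_⟩
        · have : termStep g' ρ p acc = ρ p pr := by
            simp [execStep, loadRegs, g', hp, hf]
          exact this.trans hpr
        · have : lo p = k := by rw [hk]; exact hf
          rw [this]
          exact .single k
      · have h2' := hlo p hV
        have h3 : lo p < base p + (t - loc d p 0 - loc d p 1) := by
          simp only [first] at hf
          omega
        have h4 := hτ p hV
        rw [show min (len p) (t - loc d p 0 - loc d p 1) = t - loc d p 0 - loc d p 1 by omega] at h4
        obtain ⟨w, hw, hs⟩ := h4 h3
        refine ⟨.plus w (.times (.entryA (i p) k) (.entryB k (j p))), ?_, .plus ?_ (.single k)⟩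
        · have : termStep g' ρ p acc = Option.map₂ Term.plus (ρ p acc) (ρ p pr) := by
            simp [execStep, loadRegs, g', hp, hf, n15, OpKind.fn]
          rw [this, hρ_acc, hw, hpr]
          rfl
        · rw [hk]; exact hs
    · have : termStep g' ρ p acc = ρ p acc := by simp [execStep, loadRegs, g', hp]
      rw [this, hρ_acc]
      have e : min (len p) (t + 1 - loc d p 0 - loc d p 1) =
          min (len p) (t - loc d p 0 - loc d p 1) := by
        simp only [on, hV, true_and, not_and, not_lt] at hp
        omega
      rw [e]
      exact hτ p hV
  · intro p r hr
    have hr' := hr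
    simp only [List.mem_cons, List.not_mem_nil, or_false, not_or] at hr
    rw [hg' p r hr.2.2.2.2.2, hρ_other p r (by simp [hr]), hrest p r hr']

end Layer

/-! ### The places of the entries of a block -/

section Homes

variable {s n d : ℕ}

/-- The layers of a subcube are numbered by two digits with this base. -/
def layerBase (s d : ℕ) : ℕ := Nat.sqrt (subEdge s d)

/-- A subcube can hold one entry per processor of a matrix of this side. -/
def chunk (s d : ℕ) : ℕ := subEdge s d * layerBase s d

/-- The row of the entry that has its place at `p`, for the chunk of rows with number `c` of
the block which is given by the coordinate on the axis `β`. -/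
def rowIdx (n d : ℕ) (β : Fin 3) (c : ℕ) (p : Proc s) : ℕ :=
  blockStart (2 ^ d) n (blk d p β) +
    -- The leading digit of the layer number selects a band of rows, the trailing digit a band of
    -- columns; a layer thus holds one square of the chunk.
    (c * chunk s d + loc d p 2 / layerBase s d * subEdge s d + loc d p 0)

/-- The column of the entry that has its place at `p`. -/
def colIdx (n d : ℕ) (γ : Fin 3) (c : ℕ) (p : Proc s) : ℕ :=
  blockStart (2 ^ d) n (blk d p γ) +
    (c * chunk s d + loc d p 2 % layerBase s d * subEdge s d + loc d p 1)

/-- The processor `p` is the place of an entry of the chunk `(c, c')`. -/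
structure IsPlace (n d : ℕ) (β γ : Fin 3) (c c' : ℕ) (p : Proc s) : Prop where
  loc_lt : ∀ a, loc d p a < subEdge s d
  layer_lt : loc d p 2 < layerBase s d * layerBase s d
  row_lt : rowIdx n d β c p < blockStart (2 ^ d) n (blk d p β + 1)
  col_lt : colIdx n d γ c' p < blockStart (2 ^ d) n (blk d p γ + 1)

variable {β γ φ : Fin 3} {c c' : ℕ} {p q : Proc s}

lemma blockStart_blk_succ_le (n : ℕ) (p : Proc s) (a : Fin 3) :
    blockStart (2 ^ d) n (blk d p a + 1) ≤ n := by
  have := blockStart_mono (D := 2 ^ d) (N := n) (show blk d p a + 1 ≤ 2 ^ d from blk_lt p a)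
  rwa [blockStart_self (by positivity)] at this

lemma IsPlace.rowIdx_lt (h : IsPlace n d β γ c c' p) : rowIdx n d β c p < n :=
  h.row_lt.trans_le (blockStart_blk_succ_le n p β)

lemma IsPlace.colIdx_lt (h : IsPlace n d β γ c c' p) : colIdx n d γ c' p < n :=
  h.col_lt.trans_le (blockStart_blk_succ_le n p γ)

lemma IsPlace.part_row (h : IsPlace n d β γ c c' p) : part n d (rowIdx n d β c p) = blk d p β :=
  (part_eq_iff (by have := h.rowIdx_lt; omega)).2 ⟨Nat.le_add_right _ _, h.row_lt⟩

lemma IsPlace.part_col (h : IsPlace n d β γ c c' p) : part n d (colIdx n d γ c' p) = blk d p γ :=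
  (part_eq_iff (by have := h.colIdx_lt; omega)).2 ⟨Nat.le_add_right _ _, h.col_lt⟩

lemma rowIdx_congr (hb : blk d p β = blk d q β) (h2 : loc d p 2 / layerBase s d =
    loc d q 2 / layerBase s d) (h0 : loc d p 0 = loc d q 0) :
    rowIdx n d β c p = rowIdx n d β c q := by
  unfold rowIdx
  rw [hb, h2, h0]

lemma colIdx_congr (hb : blk d p γ = blk d q γ) (h2 : loc d p 2 % layerBase s d =
    loc d q 2 % layerBase s d) (h1 : loc d p 1 = loc d q 1) :
    colIdx n d γ c p = colIdx n d γ c q := by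
  unfold colIdx
  rw [hb, h2, h1]

lemma digits_unique {b x x' y y' : ℕ} (hy : y < b) (hy' : y' < b) (h : x * b + y = x' * b + y') :
    x = x' ∧ y = y' := by
  have hb : 0 < b := by omega
  have h1 := congrArg (· / b) h
  have h2 := congrArg (· % b) h
  simp only [Nat.mul_comm _ b, Nat.mul_add_div hb, Nat.mul_add_mod, Nat.div_eq_of_lt hy,
    Nat.div_eq_of_lt hy', Nat.mod_eq_of_lt hy, Nat.mod_eq_of_lt hy', add_zero] at h1 h2
  exact ⟨h1, h2⟩

/-- The place of an entry is unique. -/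
lemma IsPlace.eq_of_idx_eq (hcov : ∀ a, a = β ∨ a = γ ∨ a = φ) (hp : IsPlace n d β γ c c' p)
    (hq : IsPlace n d β γ c c' q) (hφ : blk d p φ = blk d q φ)
    (hrow : rowIdx n d β c p = rowIdx n d β c q) (hcol : colIdx n d γ c' p = colIdx n d γ c' q) :
    p = q := by
  have hβ : blk d p β = blk d q β := by rw [← hp.part_row, hrow, hq.part_row]
  have hγ : blk d p γ = blk d q γ := by rw [← hp.part_col, hcol, hq.part_col]
  rw [rowIdx, rowIdx, hβ] at hrow
  rw [colIdx, colIdx, hγ] at hcol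
  obtain ⟨e1, e0⟩ := digits_unique (hp.loc_lt 0) (hq.loc_lt 0)
    (by omega : loc d p 2 / layerBase s d * subEdge s d + loc d p 0 =
      loc d q 2 / layerBase s d * subEdge s d + loc d q 0)
  obtain ⟨e2, e3⟩ := digits_unique (hp.loc_lt 1) (hq.loc_lt 1)
    (by omega : loc d p 2 % layerBase s d * subEdge s d + loc d p 1 =
      loc d q 2 % layerBase s d * subEdge s d + loc d q 1)
  refine proc_ext (d := d) (fun a => ?_) (fun a => ?_)
  · rcases hcov a with rfl | rfl | rfl <;> assumption
  · fin_cases a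
    · exact e0
    · exact e3
    · change loc d p 2 = loc d q 2
      rw [← Nat.div_add_mod (loc d p 2) (layerBase s d), e1, e2, Nat.div_add_mod]

lemma exists_proc {B X : Fin 3 → ℕ} (hB : ∀ a, B a < 2 ^ d) (hX : ∀ a, X a < subEdge s d) :
    ∃ p : Proc s, (∀ a, blk d p a = B a) ∧ ∀ a, loc d p a = X a := by
  let p : Proc s := fun a => ⟨_, blockStart_add_lt (hB a) (hX a)⟩
  have hp : ∀ a, p = place d p a (B a) (X a) := by
    intro a
    rw [place, dif_pos (blockStart_add_lt (hB a) (hX a))]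
    exact (Function.update_eq_self a p).symm
  refine ⟨p, fun a => ?_, fun a => ?_⟩
  · rw [hp a]; exact blk_place_self p (hB a) (hX a)
  · rw [hp a]; exact loc_place_self p (hB a) (hX a)

/-- The decomposition of an index into the numbers of the block and the chunk and two digits. -/
lemma exists_digits {i N : ℕ} (hi : i < n) (hs : 2 ^ d ≤ s) (hN : n / 2 ^ d + 1 ≤ N * chunk s d) :
    ∃ a < N, ∃ b < layerBase s d, ∃ x < subEdge s d, part n d i < 2 ^ d ∧
      i < blockStart (2 ^ d) n (part n d i + 1) ∧
      i = blockStart (2 ^ d) n (part n d i) + (a * chunk s d + b * subEdge s d + x) := by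
  have hL : 0 < subEdge s d := Nat.div_pos hs (by positivity)
  have hl : 0 < layerBase s d := Nat.sqrt_pos.2 hL
  obtain ⟨h1, h2⟩ := (part_eq_iff (d := d) (N := n) (x := i) (by omega)).1 rfl
  -- A part has at most `n / 2 ^ d + 1` elements, hence `N` chunks exhaust it.
  have h3 := blockStart_add_le (D := 2 ^ d) (N := n) (K := part n d i) (by positivity) 1
  rw [one_mul] at h3
  set u := i - blockStart (2 ^ d) n (part n d i) with hu
  have hc : 0 < chunk s d := Nat.mul_pos hL hl
  refine ⟨u / chunk s d, ?_, u % chunk s d / subEdge s d, ?_, u % chunk s d % subEdge s d,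
    Nat.mod_lt _ hL, part_lt hi, h2, ?_⟩
  · rw [Nat.div_lt_iff_lt_mul hc]
    omega
  · rw [Nat.div_lt_iff_lt_mul hL, mul_comm]
    exact Nat.mod_lt _ hc
  · have e1 := Nat.div_add_mod u (chunk s d)
    have e2 := Nat.div_add_mod (u % chunk s d) (subEdge s d)
    rw [mul_comm] at e1 e2
    omega

/-- Every entry has a place. -/
lemma exists_isPlace (hβγ : β ≠ γ) (hβφ : β ≠ φ) (hγφ : γ ≠ φ) {N : ℕ} (hs : 2 ^ d ≤ s)
    (hN : n / 2 ^ d + 1 ≤ N * chunk s d) (i k : Fin n) :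
    ∃ c < N, ∃ c' < N, ∃ p : Proc s, IsPlace n d β γ c c' p ∧ blk d p φ = 0 ∧
      (i : ℕ) = rowIdx n d β c p ∧ (k : ℕ) = colIdx n d γ c' p := by
  obtain ⟨a, ha, b, hb, x, hx, h1, h2, h3⟩ := exists_digits i.isLt hs hN
  obtain ⟨a', ha', b', hb', x', hx', h1', h2', h3'⟩ := exists_digits k.isLt hs hN
  have hl : 0 < layerBase s d := by omega
  have hz : b * layerBase s d + b' < layerBase s d * layerBase s d := by
    calc b * layerBase s d + b' < b * layerBase s d + layerBase s d := by omega
      _ = (b + 1) * layerBase s d := by ring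
      _ ≤ layerBase s d * layerBase s d := Nat.mul_le_mul_right _ hb
  obtain ⟨p, hB, hX⟩ := exists_proc (s := s) (d := d)
    (B := fun e => if e = β then part n d i else if e = γ then part n d k else 0)
    (X := ![x, x', b * layerBase s d + b'])
    (fun e => by split_ifs <;> first | assumption | positivity)
    (fun e => by
      fin_cases e
      · exact hx
      · exact hx'
      · exact hz.trans_le (Nat.sqrt_le _))
  have e0 : loc d p 0 = x := hX 0
  have e1 : loc d p 1 = x' := hX 1
  have e2 : loc d p 2 = b * layerBase s d + b' := hX 2
  have bβ : blk d p β = part n d i := by rw [hB, if_pos rfl]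
  have bγ : blk d p γ = part n d k := by rw [hB, if_neg hβγ.symm, if_pos rfl]
  have ez : loc d p 2 / layerBase s d = b ∧ loc d p 2 % layerBase s d = b' := by
    rw [e2, mul_comm, Nat.mul_add_div hl, Nat.mul_add_mod, Nat.div_eq_of_lt hb',
      Nat.mod_eq_of_lt hb']
    exact ⟨rfl, rfl⟩
  have hrow : (i : ℕ) = rowIdx n d β a p := by rw [rowIdx, bβ, ez.1, e0]; exact h3
  have hcol : (k : ℕ) = colIdx n d γ a' p := by rw [colIdx, bγ, ez.2, e1]; exact h3'
  refine ⟨a, ha, a', ha', p, ⟨fun e => ?_, by rw [e2]; exact hz, ?_, ?_⟩, ?_, hrow, hcol⟩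
  · fin_cases e
    · change loc d p 0 < _; omega
    · change loc d p 1 < _; omega
    · change loc d p 2 < _; rw [e2]; exact hz.trans_le (Nat.sqrt_le _)
  · rw [← hrow, bβ]; exact h2
  · rw [← hcol, bγ]; exact h2'
  · rw [hB, if_neg hβφ.symm, if_neg hγφ.symm]

/-- There is a permutation that brings the entries from their places to a given layout. -/
lemma exists_perm_of_layout (hcov : ∀ a, a = β ∨ a = γ ∨ a = φ) (c c' : ℕ) (M : Layout n s) :
    ∃ π : Equiv.Perm (Proc s), ∀ p, IsPlace n d β γ c c' p → blk d p φ = 0 → ∀ i k : Fin n,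
      (i : ℕ) = rowIdx n d β c p → (k : ℕ) = colIdx n d γ c' p → π p = M (i, k) := by
  classical
  let f : Proc s → Proc s := fun p =>
    if h : rowIdx n d β c p < n ∧ colIdx n d γ c' p < n then M (⟨_, h.1⟩, ⟨_, h.2⟩) else p
  let S : Finset (Proc s) := Finset.univ.filter fun p => IsPlace n d β γ c c' p ∧ blk d p φ = 0
  have hf : ∀ p, IsPlace n d β γ c c' p → ∀ i k : Fin n, (i : ℕ) = rowIdx n d β c p →
      (k : ℕ) = colIdx n d γ c' p → f p = M (i, k) := by
    intro p hp i k hi hk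
    simp only [f]
    rw [dif_pos ⟨hp.rowIdx_lt, hp.colIdx_lt⟩]
    congr 2
    · exact Fin.ext hi.symm
    · exact Fin.ext hk.symm
  -- Restricted to block number 0 on the axis `φ`, each entry of the chunk has only one place; this
  -- partial injection extends to a permutation of the mesh.
  obtain ⟨g, hg⟩ := Finset.exists_equiv_extend_of_card_eq (α := Proc s)
    (t := (Finset.univ : Finset (Proc s))) (by simp) (s := S) (f := f) (Finset.subset_univ _) (by
      intro p hp q hq hpq
      have hp : IsPlace n d β γ c c' p ∧ blk d p φ = 0 := by simpa [S] using hp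
      have hq : IsPlace n d β γ c c' q ∧ blk d q φ = 0 := by simpa [S] using hq
      rw [hf p hp.1 ⟨_, hp.1.rowIdx_lt⟩ ⟨_, hp.1.colIdx_lt⟩ rfl rfl,
        hf q hq.1 ⟨_, hq.1.rowIdx_lt⟩ ⟨_, hq.1.colIdx_lt⟩ rfl rfl] at hpq
      have := M.injective hpq
      simp only [Prod.mk.injEq, Fin.mk.injEq] at this
      exact hp.1.eq_of_idx_eq hcov hq.1 (hp.2.trans hq.2.symm) this.1 this.2)
  refine ⟨g.trans (Equiv.subtypeUnivEquiv fun p => Finset.mem_univ p), fun p hp hφ i k hi hk => ?_⟩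
  have := hg p (by simp [S, hp, hφ])
  rw [← hf p hp i k hi hk, ← this]
  rfl

variable {R : ℕ}

/-- The entries of a matrix are brought to their places in all subcubes. -/
lemma reach_distribute (hcov : ∀ a, a = β ∨ a = γ ∨ a = φ) (hβφ : β ≠ φ) (hγφ : γ ≠ φ) (c c' : ℕ)
    (M : Layout n s) (e : Fin n → Fin n → Term n) {src dst mid x y tmp : Fin R}
    (hr : [src, mid, x, y, tmp, dst].Nodup) (σ : TermRegs n s R)
    (hσ : ∀ i k, σ (M (i, k)) src = some (e i k)) :
    Reach d (fun τ => (∀ p, IsPlace n d β γ c c' p → ∀ i k : Fin n, (i : ℕ) = rowIdx n d β c p →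
        (k : ℕ) = colIdx n d γ c' p → τ p dst = some (e i k)) ∧
      ∀ p r, r ∉ [dst, mid, x, y, tmp] → τ p r = σ p r) (12 * s + 12) σ := by
  -- The axes `(β, γ, φ)` are `(0,1,2)` for `A` and `(1,2,0)` for `B`. The permutation fills the
  -- subcubes with number 0 on the axis `φ`, on which the block does not depend; a fetch along `φ`
  -- copies the entries to all others.
  obtain ⟨π, hπ⟩ := exists_perm_of_layout (d := d) hcov c c' M
  have hr' := hr
  simp only [List.nodup_cons, List.mem_cons, List.not_mem_nil, or_false, not_or] at hr
  obtain ⟨-, ⟨-, -, n3, n4⟩, -, -, n5, -⟩ := hr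
  refine ((reach_permute π (hr'.sublist (by simp) : [src, mid, x, y, tmp].Nodup)
    (fun _ => True) σ).bind fun σ₁ e1 =>
    (reach_fetch φ n4 n3 (Ne.symm n5) (fun p => loc d p φ < subEdge s d)
      (fun p => place d p φ 0 (loc d p φ)) s ?_ σ₁).weaken le_rfl fun σ₂ e2 => ?_).weaken
      (by omega) fun _ h => h
  · intro p _
    exact ⟨fun b hb => place_of_ne p _ _ hb, by omega, by omega⟩
  · refine ⟨fun p hp i k hi hk => ?_, fun p r hr => ?_⟩
    · have hφ := hp.loc_lt φ
      rw [e2.1 p hφ, e1.1 _ trivial]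
      have h0 : (0 : ℕ) < 2 ^ d := by positivity
      have hloc : ∀ a, loc d (place d p φ 0 (loc d p φ)) a = loc d p a := by
        intro a
        by_cases ha : a = φ
        · subst ha; exact loc_place_self p h0 hφ
        · exact loc_place_of_ne p _ _ ha
      have bβ := blk_place_of_ne (d := d) p 0 (loc d p φ) hβφ
      have bγ := blk_place_of_ne (d := d) p 0 (loc d p φ) hγφ
      have hrow : rowIdx n d β c (place d p φ 0 (loc d p φ)) = rowIdx n d β c p :=
        rowIdx_congr bβ (by rw [hloc]) (hloc 0)
      have hcol : colIdx n d γ c' (place d p φ 0 (loc d p φ)) = colIdx n d γ c' p :=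
        colIdx_congr bγ (by rw [hloc]) (hloc 1)
      rw [hπ _ ⟨fun a => by rw [hloc]; exact hp.loc_lt a, by rw [hloc]; exact hp.layer_lt,
        by rw [hrow, bβ]; exact hp.row_lt, by rw [hcol, bγ]; exact hp.col_lt⟩
        (blk_place_self p h0 hφ) i k (by rw [hrow, hi]) (by rw [hcol, hk]), hσ]
    · simp only [List.mem_cons, List.not_mem_nil, or_false, not_or] at hr
      rw [e2.2.2 p r hr.1 hr.2.2.2.2, e1.2.2 p r (by simp [hr])]

end Homes

/-! ### The stages of the algorithm

The registers are used as follows: 0, 1, 2 for the given entries of `A` and `B` and the results,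
3 and 4 for the entries of `A` and `B` at their places, 5–8 for the entries that pass by in
the multiplication in a layer, 9 for a product, 10 for the partial sum, 11–13 for
routing. -/

section Stages

variable {s n d : ℕ}

/-- The number `x`, which is less than `n` whenever this is used, as an index. -/
def toIdx (hn : 0 < n) (x : ℕ) : Fin n := ⟨x % n, Nat.mod_lt _ hn⟩

lemma val_toIdx {hn : 0 < n} {x : ℕ} (hx : x < n) : (toIdx hn x : ℕ) = x := Nat.mod_eq_of_lt hx

/-- The end of the summation range of the block of `p`, if only `m` summands are taken. -/
def sumEnd (n d : ℕ) (p : Proc s) (m : ℕ) : ℕ :=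
  min (blockStart (2 ^ d) n (blk d p 1) + m) (blockStart (2 ^ d) n (blk d p 1 + 1))

/-- All places for `C` hold the sum of the first `m` summands of their blocks. -/
def Accumulated (d : ℕ) (hn : 0 < n) (c c' m : ℕ) (σ : TermRegs n s 14) : Prop :=
  ∀ p, IsPlace n d 0 2 c c' p → Holds (toIdx hn (rowIdx n d 0 c p)) (toIdx hn (colIdx n d 2 c' p))
    (blockStart (2 ^ d) n (blk d p 1)) (sumEnd n d p m) (σ p 10)

/-- The entries of `A` and `B` are at their places. -/
def Distributed (n d ci ck cj : ℕ) (σ : TermRegs n s 14) : Prop :=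
  (∀ p, IsPlace n d 0 1 ci ck p → ∀ i k : Fin n, (i : ℕ) = rowIdx n d 0 ci p →
    (k : ℕ) = colIdx n d 1 ck p → σ p 3 = some (.entryA i k)) ∧
  ∀ p, IsPlace n d 1 2 ck cj p → ∀ k j : Fin n, (k : ℕ) = rowIdx n d 1 ck p →
    (j : ℕ) = colIdx n d 2 cj p → σ p 4 = some (.entryB k j)

lemma layer_lt {b b' l : ℕ} (hb : b < l) (hb' : b' < l) : b * l + b' < l * l :=
  calc b * l + b' < b * l + l := by omega
    _ = (b + 1) * l := by ring
    _ ≤ l * l := Nat.mul_le_mul_right _ hb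

/-- One round of the multiplication of chunks: in the layer with the digits `(b, b')`, the squares
`(b, q)` of `A` and `(q, b')` of `B` are multiplied. -/
lemma reach_round (hn : 0 < n) {ci ck cj q : ℕ} (hq : q < layerBase s d) {σ : TermRegs n s 14}
    (hD : Distributed n d ci ck cj σ)
    (hacc : Accumulated d hn ci cj (ck * chunk s d + q * subEdge s d) σ) :
    Reach d (fun τ => Accumulated d hn ci cj (ck * chunk s d + (q + 1) * subEdge s d) τ ∧
      ∀ p r, r ∉ [5, 6, 7, 8, 9, 10, 13] → τ p r = σ p r) (10 * subEdge s d + 4) σ := by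
  set l := layerBase s d with hl
  set L := subEdge s d with hL
  have hlL : l * l ≤ L := Nat.sqrt_le _
  have hdist : ∀ (p : Proc s) x, loc d p 2 < L → x < L → (∀ b, b ≠ 2 → setLoc d p 2 x b = p b) ∧
      (setLoc d p 2 x 2 : ℕ) ≤ p 2 + L ∧ (p 2 : ℕ) ≤ setLoc d p 2 x 2 + L := by
    intro p x hp hx
    have h1 : (setLoc d p 2 x 2 : ℕ) = _ := place_self p (blk_lt p 2) hx
    have h2 := blockStart_add_loc (d := d) p 2
    exact ⟨fun b hb => place_of_ne p _ _ hb, by omega, by omega⟩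
  have hzA : ∀ p : Proc s, loc d p 2 < l * l → loc d p 2 / l * l + q < l * l := fun p hp =>
    layer_lt ((Nat.div_lt_iff_lt_mul (by omega)).2 hp) hq
  have hzB : ∀ p : Proc s, q * l + loc d p 2 % l < l * l := fun p =>
    layer_lt hq (Nat.mod_lt _ (by omega))
  -- The layer `b * l + b'` reads `A` from layer `b * l + q` and `B` from layer `q * l + b'`, both
  -- in the same subcube. Two fetches of `2 * L + 2` steps and `6 * L` steps of multiplication give
  -- the bound.
  refine ((reach_fetch (src := 3) (dst := 5) (tmp := 13) 2 (by decide) (by decide) (by decide)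
    (fun p => loc d p 2 < l * l) (fun p => setLoc d p 2 (loc d p 2 / l * l + q)) L
    (fun p hp => hdist p _ (by omega) ((hzA p hp).trans_le hlL)) σ).bind fun σ₁ e1 =>
    (reach_fetch (src := 4) (dst := 7) (tmp := 13) 2 (by decide) (by decide) (by decide)
    (fun p => loc d p 2 < l * l) (fun p => setLoc d p 2 (q * l + loc d p 2 % l)) L
    (fun p hp => hdist p _ (by omega) ((hzB p).trans_le hlL)) σ₁).bind fun σ₂ e2 =>
    (reach_layer_product (aTop := 5) (aBot := 6) (bTop := 7) (bBot := 8) (pr := 9) (acc := 10) (by decide)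
      (IsPlace n d 0 2 ci cj) (fun p => toIdx hn (rowIdx n d 0 ci p))
      (fun p => toIdx hn (colIdx n d 2 cj p)) (fun p => blockStart (2 ^ d) n (blk d p 1))
      (fun p => sumEnd n d p (ck * chunk s d + q * L))
      (fun p => sumEnd n d p (ck * chunk s d + (q + 1) * L) -
        sumEnd n d p (ck * chunk s d + q * L)) σ₂ ?_ ?_ ?_ ?_ ?_ ?_ ?_).weaken le_rfl
      fun τ e3 => ?_).weaken (by omega : _ ≤ 10 * L + 4) fun _ h => h
  · intro p hp
    refine ⟨?_, hp.loc_lt 0, hp.loc_lt 1⟩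
    simp only [sumEnd, add_mul, one_mul]
    omega
  · intro p hp
    have := blockStart_mono (D := 2 ^ d) (N := n) (Nat.le_succ (blk d p 1))
    simp only [sumEnd, Nat.succ_eq_add_one] at this ⊢
    omega
  · intro p hp
    have := blockStart_blk_succ_le (d := d) n p 1
    simp only [sumEnd, add_mul, one_mul]
    omega
  · intro p hp k x hx hk
    have hz := hp.layer_lt
    have hx' : x < L ∧ (k : ℕ) = blockStart (2 ^ d) n (blk d p 1) + (ck * chunk s d + q * L + x) ∧
        (k : ℕ) < blockStart (2 ^ d) n (blk d p 1 + 1) := by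
      simp only [sumEnd, add_mul, one_mul] at hx hk
      omega
    obtain ⟨hxL, hk1, hk2⟩ := hx'
    have e12 : loc d (setLoc d p 1 x) 2 = loc d p 2 := loc_setLoc_of_ne p x (by decide)
    rw [e2.2.2 _ _ (by decide) (by decide), e1.1 _ (by rw [e12]; exact hz), e12]
    have hz' := hzA p hz
    have hzL := hz'.trans_le hlL
    set p' := setLoc d (setLoc d p 1 x) 2 (loc d p 2 / l * l + q) with hp'
    have b : ∀ a, blk d p' a = blk d p a := fun a => by
      rw [hp', blk_setLoc _ 2 a hzL, blk_setLoc _ 1 a hxL]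
    have l0 : loc d p' 0 = loc d p 0 := by
      rw [hp', loc_setLoc_of_ne _ _ (by decide), loc_setLoc_of_ne _ _ (by decide)]
    have l1 : loc d p' 1 = x := by rw [hp', loc_setLoc_of_ne _ _ (by decide), loc_setLoc_self _ hxL]
    have l2 : loc d p' 2 = loc d p 2 / l * l + q := by rw [hp', loc_setLoc_self _ hzL]
    have l2d : loc d p' 2 / l = loc d p 2 / l := by
      rw [l2, mul_comm, Nat.mul_add_div (by omega), Nat.div_eq_of_lt hq, add_zero]
    have l2m : loc d p' 2 % l = q := by
      rw [l2, mul_comm, Nat.mul_add_mod, Nat.mod_eq_of_lt hq]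
    have hrow : rowIdx n d 0 ci p' = rowIdx n d 0 ci p := rowIdx_congr (b 0) l2d l0
    have hcol : (k : ℕ) = colIdx n d 1 ck p' := by
      rw [colIdx, ← hl, ← hL, b 1, l2m, l1]; exact hk1
    refine hD.1 p' ⟨fun a => ?_, by rw [l2]; exact hz', ?_, ?_⟩ _ _ ?_ hcol
    · fin_cases a
      · change loc d p' 0 < _; rw [l0]; exact hp.loc_lt 0
      · change loc d p' 1 < _; rw [l1]; exact hxL
      · change loc d p' 2 < _; rw [l2]; exact hzL
    · rw [hrow, b]; exact hp.row_lt
    · rw [← hcol, b]; exact hk2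
    · rw [hrow]; exact val_toIdx hp.rowIdx_lt
  · intro p hp k x hx hk
    have hz := hp.layer_lt
    have hx' : x < L ∧ (k : ℕ) = blockStart (2 ^ d) n (blk d p 1) + (ck * chunk s d + q * L + x) ∧
        (k : ℕ) < blockStart (2 ^ d) n (blk d p 1 + 1) := by
      simp only [sumEnd, add_mul, one_mul] at hx hk
      omega
    obtain ⟨hxL, hk1, hk2⟩ := hx'
    have e12 : loc d (setLoc d p 0 x) 2 = loc d p 2 := loc_setLoc_of_ne p x (by decide)
    rw [e2.1 _ (by rw [e12]; exact hz), e1.2.2 _ _ (by decide) (by decide), e12]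
    have hz' := hzB p
    have hzL := hz'.trans_le hlL
    set p' := setLoc d (setLoc d p 0 x) 2 (q * l + loc d p 2 % l) with hp'
    have b : ∀ a, blk d p' a = blk d p a := fun a => by
      rw [hp', blk_setLoc _ 2 a hzL, blk_setLoc _ 0 a hxL]
    have l0 : loc d p' 0 = x := by rw [hp', loc_setLoc_of_ne _ _ (by decide), loc_setLoc_self _ hxL]
    have l1 : loc d p' 1 = loc d p 1 := by
      rw [hp', loc_setLoc_of_ne _ _ (by decide), loc_setLoc_of_ne _ _ (by decide)]
    have l2 : loc d p' 2 = q * l + loc d p 2 % l := by rw [hp', loc_setLoc_self _ hzL]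
    have l2d : loc d p' 2 / l = q := by
      rw [l2, mul_comm, Nat.mul_add_div (by omega), Nat.div_eq_of_lt (Nat.mod_lt _ (by omega)),
        add_zero]
    have l2m : loc d p' 2 % l = loc d p 2 % l := by
      rw [l2, mul_comm, Nat.mul_add_mod, Nat.mod_mod]
    have hrow : (k : ℕ) = rowIdx n d 1 ck p' := by
      rw [rowIdx, ← hl, ← hL, b 1, l2d, l0]; exact hk1
    have hcol : colIdx n d 2 cj p' = colIdx n d 2 cj p := colIdx_congr (b 2) l2m l1
    refine hD.2 p' ⟨fun a => ?_, by rw [l2]; exact hz', ?_, ?_⟩ _ _ hrow ?_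
    · fin_cases a
      · change loc d p' 0 < _; rw [l0]; exact hxL
      · change loc d p' 1 < _; rw [l1]; exact hp.loc_lt 1
      · change loc d p' 2 < _; rw [l2]; exact hzL
    · rw [← hrow, b]; exact hk2
    · rw [hcol, b]; exact hp.col_lt
    · rw [hcol]; exact val_toIdx hp.colIdx_lt
  · intro p hp
    rw [e2.2.2 _ _ (by decide) (by decide), e1.2.2 _ _ (by decide) (by decide)]
    exact hacc p hp
  · intro p hp k h1 h2
    refine ⟨?_, (part_eq_iff hn).2 ⟨h1, ?_⟩, ?_⟩
    · rw [val_toIdx hp.rowIdx_lt]; exact hp.part_row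
    · change (k : ℕ) < blockStart (2 ^ d) n (blk d p 1 + 1)
      simp only [sumEnd] at h2
      omega
    · rw [val_toIdx hp.colIdx_lt]; exact hp.part_col
  · refine ⟨fun p hp => ?_, fun p r hr => ?_⟩
    · have := e3.1 p hp
      have h2 : sumEnd n d p (ck * chunk s d + q * L) +
          (sumEnd n d p (ck * chunk s d + (q + 1) * L) - sumEnd n d p (ck * chunk s d + q * L)) =
          sumEnd n d p (ck * chunk s d + (q + 1) * L) := by
        simp only [sumEnd, add_mul, one_mul]
        omega
      rwa [h2] at this
    · simp only [List.mem_cons, List.not_mem_nil, or_false, not_or] at hr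
      rw [e3.2 p r (by simp [hr]), e2.2.2 p r (by simp [hr]) (by simp [hr]),
        e1.2.2 p r (by simp [hr]) (by simp [hr])]

/-- The given entries are where the layouts prescribe. -/
def InputKept (LA LB : Layout n s) (σ : TermRegs n s 14) : Prop :=
  (∀ i k, σ (LA (i, k)) 0 = some (.entryA i k)) ∧ ∀ k j, σ (LB (k, j)) 1 = some (.entryB k j)

lemma InputKept.congr {LA LB : Layout n s} {σ τ : TermRegs n s 14} (h : InputKept LA LB σ)
    (h0 : ∀ p, τ p 0 = σ p 0) (h1 : ∀ p, τ p 1 = σ p 1) : InputKept LA LB τ :=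
  ⟨fun i k => (h0 _).trans (h.1 i k), fun k j => (h1 _).trans (h.2 k j)⟩

/-- The multiplication of the chunks `(ci, ck)` and `(ck, cj)` of all blocks. -/
lemma reach_chunk_product (hn : 0 < n) (LA LB : Layout n s) {ci ck cj : ℕ} {σ : TermRegs n s 14}
    (hin : InputKept LA LB σ) (hacc : Accumulated d hn ci cj (ck * chunk s d) σ) :
    Reach d (fun τ => Accumulated d hn ci cj ((ck + 1) * chunk s d) τ ∧
      ∀ p r, r ∈ [0, 1, 2] → τ p r = σ p r)
      (24 * s + 24 + layerBase s d * (10 * subEdge s d + 4)) σ := by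
  -- A processor keeps only one placed entry of each matrix, so the chunks are brought anew from the
  -- original layouts for every product of chunks.
  refine ((reach_distribute (β := 0) (γ := 1) (φ := 2) (by decide) (by decide) (by decide) ci ck LA
    Term.entryA (src := 0) (dst := 3) (mid := 5) (x := 11) (y := 12) (tmp := 13) (by decide) σ
    hin.1).bind fun σ₁ e1 =>
    (reach_distribute (β := 1) (γ := 2) (φ := 0) (by decide) (by decide) (by decide) ck cj LB
    Term.entryB (src := 1) (dst := 4) (mid := 5) (x := 11) (y := 12) (tmp := 13) (by decide) σ₁
    (fun k j => (e1.2 _ _ (by decide)).trans (hin.2 k j))).bind fun σ₂ e2 => ?_).weaken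
    (by omega : (12 * s + 12) + ((12 * s + 12) + layerBase s d * (10 * subEdge s d + 4)) ≤ _)
    fun _ h => h
  let Inv : ℕ → TermRegs n s 14 → Prop := fun q τ =>
    Distributed n d ci ck cj τ ∧ Accumulated d hn ci cj (ck * chunk s d + q * subEdge s d) τ ∧
    ∀ p r, r ∈ [0, 1, 2] → τ p r = σ p r
  refine (Reach.loop (Inv := Inv) (layerBase s d) ?_ ?_).weaken le_rfl fun τ hτ => ⟨?_, hτ.2.2⟩
  · rintro q hq τ ⟨h1, h2, h3⟩
    refine (reach_round hn hq h1 h2).weaken le_rfl fun ρ hρ => ⟨?_, hρ.1, fun p r hr => ?_⟩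
    · refine ⟨fun p hp i k hi hk => ?_, fun p hp k j hk hj => ?_⟩
      · rw [hρ.2 _ _ (by decide)]; exact h1.1 p hp i k hi hk
      · rw [hρ.2 _ _ (by decide)]; exact h1.2 p hp k j hk hj
    · rw [hρ.2 p r (by revert r; decide), h3 p r hr]
  · refine ⟨⟨fun p hp i k hi hk => ?_, e2.1⟩, fun p hp => ?_, fun p r hr => ?_⟩
    · rw [e2.2 _ _ (by decide)]; exact e1.1 p hp i k hi hk
    · rw [e2.2 _ _ (by decide), e1.2 _ _ (by decide), zero_mul, add_zero]
      exact hacc p hp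
    · rw [e2.2 p r (by revert r; decide), e1.2 p r (by revert r; decide)]
  · have : ck * chunk s d + layerBase s d * subEdge s d = (ck + 1) * chunk s d := by
      rw [add_mul, one_mul, mul_comm (layerBase s d), ← chunk]
    rw [← this]
    exact hτ.2.1

/-- All places for `C` whose block number on the axis of summation is divisible by `2 ^ e` hold the
sum over the ranges of `2 ^ e` blocks. -/
def TreeSum (d : ℕ) (hn : 0 < n) (c c' e : ℕ) (σ : TermRegs n s 14) : Prop :=
  ∀ p, IsPlace n d 0 2 c c' p → 2 ^ e ∣ blk d p 1 →
    Holds (toIdx hn (rowIdx n d 0 c p)) (toIdx hn (colIdx n d 2 c' p))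
    (blockStart (2 ^ d) n (blk d p 1)) (blockStart (2 ^ d) n (blk d p 1 + 2 ^ e)) (σ p 10)

/-- An aligned window of `2 * w` blocks is a node of the binary tree and its lower half is the even
child. This translates ranges of blocks into the halving conditions of `AllowedPlus`. -/
lemma halves_iff {P K w : ℕ} (hw : 0 < w) (hK : 2 * w ∣ K) :
    (P / (2 * w) = K / (2 * w) ↔ K ≤ P ∧ P < K + 2 * w) ∧
    ((P / (2 * w) = K / (2 * w) ∧ P / w % 2 = 0) ↔ K ≤ P ∧ P < K + w) := by
  obtain ⟨m, rfl⟩ := hK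
  rw [Nat.mul_div_cancel_left m (by omega), mul_comm 2 w, ← Nat.div_div_eq_div_mul]
  have h1 : ∀ x, w * x ≤ P ↔ x ≤ P / w := fun x => by
    rw [Nat.le_div_iff_mul_le hw, mul_comm]
  have h2 : ∀ x, P < w * x ↔ P / w < x := fun x => by
    rw [Nat.div_lt_iff_lt_mul hw, mul_comm]
  rw [show w * 2 * m + w * 2 = w * (2 * m + 2) by ring, show w * 2 * m + w = w * (2 * m + 1) by ring,
    mul_assoc, h1, h2, h2]
  omega

/-- One level of the recursive addition. -/
lemma reach_tree_level (hn : 2 ^ d ≤ n) {c c' e : ℕ} (he : e < d) {σ : TermRegs n s 14}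
    (hσ : TreeSum d (lt_of_lt_of_le (by positivity) hn) c c' e σ) :
    Reach d (fun τ => TreeSum d (lt_of_lt_of_le (by positivity) hn) c c' (e + 1) τ ∧
      ∀ p r, r ∈ [0, 1, 2] → τ p r = σ p r) (2 * (2 ^ e * s / 2 ^ d) + 5) σ := by
  have hn0 : 0 < n := lt_of_lt_of_le (by positivity) hn
  let M : Proc s → Prop := fun p => IsPlace n d 0 2 c c' p ∧ 2 ^ (e + 1) ∣ blk d p 1
  have hw : 0 < 2 ^ e := by positivity
  have hblk : ∀ p, M p → blk d p 1 + 2 ^ e < 2 ^ d := by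
    rintro p ⟨-, m, hm⟩
    have h1 : blk d p 1 < 2 ^ d := blk_lt p 1
    have h0 : 2 ^ d = 2 ^ (e + 1) * 2 ^ (d - (e + 1)) := by
      rw [← pow_add, Nat.add_sub_cancel' he]
    rw [h0, hm] at h1 ⊢
    have h2 : m < 2 ^ (d - (e + 1)) := Nat.lt_of_mul_lt_mul_left h1
    calc 2 ^ (e + 1) * m + 2 ^ e < 2 ^ (e + 1) * m + 2 ^ (e + 1) := by rw [pow_succ]; omega
      _ = 2 ^ (e + 1) * (m + 1) := by ring
      _ ≤ _ := Nat.mul_le_mul_left _ h2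
  -- As `2 ^ d ≤ n`, no block is empty, so `Holds` provides an expression for each half.
  have hlt : ∀ K, blockStart (2 ^ d) n K < blockStart (2 ^ d) n (K + 2 ^ e) := fun K =>
    (blockStart_lt_succ (by positivity) hn).trans_le (blockStart_mono (by omega))
  have hplace : ∀ p, M p → ∃ u v, σ p 10 = some u ∧
      σ (place d p 1 (blk d p 1 + 2 ^ e) (loc d p 1)) 10 = some v ∧
      PartialSum (toIdx hn0 (rowIdx n d 0 c p)) (toIdx hn0 (colIdx n d 2 c' p))
        (blockStart (2 ^ d) n (blk d p 1)) (blockStart (2 ^ d) n (blk d p 1 + 2 ^ e)) u ∧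
      PartialSum (toIdx hn0 (rowIdx n d 0 c p)) (toIdx hn0 (colIdx n d 2 c' p))
        (blockStart (2 ^ d) n (blk d p 1 + 2 ^ e))
        (blockStart (2 ^ d) n (blk d p 1 + 2 ^ (e + 1))) v := by
    intro p hM
    have hp := hM.1
    have hdvd : 2 ^ e ∣ blk d p 1 := (pow_dvd_pow 2 (Nat.le_succ e)).trans hM.2
    obtain ⟨u, hu, hu'⟩ := hσ p hp hdvd (hlt _)
    set p' := place d p 1 (blk d p 1 + 2 ^ e) (loc d p 1) with hp'
    have b1 : blk d p' 1 = blk d p 1 + 2 ^ e := blk_place_self p (hblk p hM) (hp.loc_lt 1)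
    have hloc : ∀ a, loc d p' a = loc d p a := by
      intro a
      by_cases ha : a = 1
      · subst ha; exact loc_place_self p (hblk p hM) (hp.loc_lt 1)
      · exact loc_place_of_ne p _ _ ha
    have b0 : blk d p' 0 = blk d p 0 := blk_place_of_ne p _ _ (by decide)
    have b2 : blk d p' 2 = blk d p 2 := blk_place_of_ne p _ _ (by decide)
    have hrow : rowIdx n d 0 c p' = rowIdx n d 0 c p := rowIdx_congr b0 (by rw [hloc]) (hloc 0)
    have hcol : colIdx n d 2 c' p' = colIdx n d 2 c' p := colIdx_congr b2 (by rw [hloc]) (hloc 1)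
    obtain ⟨v, hv, hv'⟩ := hσ p' ⟨fun a => by rw [hloc]; exact hp.loc_lt a,
      by rw [hloc]; exact hp.layer_lt, by rw [hrow, b0]; exact hp.row_lt,
      by rw [hcol, b2]; exact hp.col_lt⟩ (by rw [b1]; exact hdvd.add dvd_rfl) (hlt _)
    rw [hrow, hcol, b1, show blk d p 1 + 2 ^ e + 2 ^ e = blk d p 1 + 2 ^ (e + 1) by
      rw [pow_succ]; ring] at hv'
    exact ⟨u, v, hu, hv, hu', hv'⟩
  classical
  refine ((reach_fetch (src := 10) (dst := 5) (tmp := 13) 1 (by decide) (by decide) (by decide)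
    M (fun p => place d p 1 (blk d p 1 + 2 ^ e) (loc d p 1)) (2 ^ e * s / 2 ^ d + 1) ?_ σ).bind
    fun σ₁ e1 => (reach_op (fun p => if M p then some ⟨.plus, 10, 5, 10⟩ else none) ?_).weaken le_rfl
    fun τ e2 => ?_).weaken (by omega : _ ≤ 2 * (2 ^ e * s / 2 ^ d) + 5) fun _ h => h
  · intro p hp
    have h1 := place_self (d := d) p (a := 1) (hblk p hp) (hp.1.loc_lt 1)
    have h2 := blockStart_add_loc (d := d) p 1
    -- The partner is `2 ^ e` subcubes away with the same local coordinates, so the distance is at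
    -- most `2 ^ e * s / 2 ^ d + 1`.
    have h3 := blockStart_add_le (D := 2 ^ d) (N := s) (K := blk d p 1) (by positivity) (2 ^ e)
    have h4 := blockStart_mono (D := 2 ^ d) (N := s) (Nat.le_add_right (blk d p 1) (2 ^ e))
    exact ⟨fun b hb => place_of_ne p _ _ hb, by omega, by omega⟩
  · intro p I u v hI hu hv
    by_cases hM : M p
    swap
    · simp [hM] at hI
    simp only [hM, if_true, Option.some.injEq] at hI
    subst hI
    refine ⟨(fun h => nomatch h), fun _ => ?_⟩
    obtain ⟨u', v', hu', hv', h1, h2⟩ := hplace p hM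
    replace hu : σ₁ p 10 = some u := hu
    replace hv : σ₁ p 5 = some v := hv
    rw [e1.2.2 _ _ (by decide) (by decide), hu'] at hu
    rw [e1.1 p hM, hv'] at hv
    cases hu
    cases hv
    have hp := hM.1
    have hk1 : ∀ K (k : Fin n), blockStart (2 ^ d) n K ≤ k ↔ K ≤ part n d k := fun K k =>
      blockStart_le_iff (by positivity) hn0
    have hk2 : ∀ K (k : Fin n), (k : ℕ) < blockStart (2 ^ d) n K ↔ part n d k < K := fun K k =>
      lt_blockStart_iff (by positivity) hn0
    have e2 : d - (d - (e + 1)) = e + 1 := by omega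
    have hsub : ∀ k : Fin n, InSubcube (d - (e + 1)) p (toIdx hn0 (rowIdx n d 0 c p)) k
        (toIdx hn0 (colIdx n d 2 c' p)) ↔
        part n d k / (2 * 2 ^ e) = blk d p 1 / (2 * 2 ^ e) := by
      intro k
      have hle : d - (e + 1) ≤ d := Nat.sub_le _ _
      simp only [InSubcube, val_toIdx hp.rowIdx_lt, val_toIdx hp.colIdx_lt, part_of_le hle, e2,
        hp.part_row, hp.part_col, pow_succ']
      exact ⟨fun h => h.2.1, fun h => ⟨rfl, h, rfl⟩⟩
    have hh := fun P => halves_iff (P := P) hw (by rw [← pow_succ']; exact hM.2 :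
      2 * 2 ^ e ∣ blk d p 1)
    -- Level `e`, counted from the leaves, joins the two halves of a subproblem after `d - (e + 1)`
    -- halvings.
    refine ⟨_, _, _, _, _, h1, h2, .inr ⟨d - (e + 1), by omega, fun k => ?_, fun k => ?_⟩⟩
    · rw [hsub, hk1, hk2, (hh _).1, pow_succ']
    · rw [hsub, hk1, hk2, part_of_le (d := d) (by omega : d - (e + 1) + 1 ≤ d),
        show d - (d - (e + 1) + 1) = e by omega, (hh _).2]
  · refine ⟨fun p hp hdvd _ => ?_, fun p r hr => ?_⟩
    · have hM : M p := ⟨hp, hdvd⟩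
      obtain ⟨u, v, hu, hv, h1, h2⟩ := hplace p hM
      refine ⟨.plus u v, ?_, .plus h1 h2⟩
      rw [e2 p]
      simp only [hM, if_true, Function.update_self]
      rw [e1.2.2 _ _ (by decide) (by decide), hu, e1.1 p hM, hv]
      rfl
    · have h1 : r ≠ 10 ∧ r ≠ 5 ∧ r ≠ 13 := by revert r; decide
      rw [← e1.2.2 p r h1.2.1 h1.2.2, e2 p]
      by_cases hM : M p
      · simp [hM, h1.1]
      · simp [hM]

/-- The recursive addition. -/
lemma reach_tree (hn : 2 ^ d ≤ n) {c c' : ℕ} {σ : TermRegs n s 14}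
    (hσ : TreeSum d (lt_of_lt_of_le (by positivity) hn) c c' 0 σ) :
    Reach d (fun τ => TreeSum d (lt_of_lt_of_le (by positivity) hn) c c' d τ ∧
      ∀ p r, r ∈ [0, 1, 2] → τ p r = σ p r) (2 * s + 5 * d) σ := by
  -- The distances double from level to level, so each partial sum is at most the next distance, and
  -- the total is `2 * s` up to a constant per level.
  have hcost : ∀ m, ∑ e ∈ Finset.range m, (2 * (2 ^ e * s / 2 ^ d) + 5) ≤
      2 * (2 ^ m * s / 2 ^ d) + 5 * m := by
    intro m
    induction m with
    | zero => simp
    | succ m ih =>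
      rw [Finset.sum_range_succ]
      have := Nat.div_add_div_le_add_div (x := 2 ^ m * s) (y := 2 ^ m * s) (z := 2 ^ d)
      rw [show 2 ^ m * s + 2 ^ m * s = 2 ^ (m + 1) * s by ring] at this
      omega
  have hd := hcost d
  rw [Nat.mul_div_cancel_left s (by positivity)] at hd
  exact (Reach.loop_sum (Inv := fun e τ => TreeSum d (lt_of_lt_of_le (by positivity) hn) c c' e τ ∧
    ∀ p r, r ∈ [0, 1, 2] → τ p r = σ p r) d _ (fun e he τ hτ =>
      (reach_tree_level hn he hτ.1).weaken le_rfl fun ρ hρ =>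
        ⟨hρ.1, fun p r hr => (hρ.2 p r hr).trans (hτ.2 p r hr)⟩)
    ⟨hσ, fun _ _ _ => rfl⟩).weaken hd fun _ h => h

/-- The result `C(i,j)` is where the layout prescribes. -/
def HasResult (LC : Layout n s) (i j : Fin n) (σ : TermRegs n s 14) : Prop :=
  ∃ u, σ (LC (i, j)) 2 = some u ∧ PartialSum i j 0 n u

/-- The entries of a chunk of all blocks of `C` are complete. -/
def ChunkDone (d : ℕ) (LC : Layout n s) (c c' : ℕ) (σ : TermRegs n s 14) : Prop :=
  ∀ p : Proc s, IsPlace n d 0 2 c c' p → blk d p 1 = 0 → ∀ i j : Fin n,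
    (i : ℕ) = rowIdx n d 0 c p → (j : ℕ) = colIdx n d 2 c' p → HasResult LC i j σ

/-- The results are brought to where they are wanted. -/
lemma reach_deliver (hn : 0 < n) (LC : Layout n s) {c c' : ℕ} {σ : TermRegs n s 14}
    (hσ : TreeSum d hn c c' d σ) :
    Reach d (fun τ => ChunkDone d LC c c' τ ∧ (∀ i j, HasResult LC i j σ → HasResult LC i j τ) ∧
      ∀ p r, r ∈ [0, 1] → τ p r = σ p r) (10 * s + 10) σ := by
  obtain ⟨π, hπ⟩ := exists_perm_of_layout (d := d) (β := 0) (γ := 2) (φ := 1) (by decide) c c' LC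
  let M : Proc s → Prop := fun q => ∃ p, IsPlace n d 0 2 c c' p ∧ blk d p 1 = 0 ∧ q = π p
  refine (reach_permute π.symm (src := 10) (dst := 2) (x := 11) (y := 12) (tmp := 13) (by decide)
    M σ).weaken le_rfl fun τ hτ => ?_
  have key : ∀ p : Proc s, IsPlace n d 0 2 c c' p → blk d p 1 = 0 → ∀ i j : Fin n,
      (i : ℕ) = rowIdx n d 0 c p → (j : ℕ) = colIdx n d 2 c' p → HasResult LC i j τ := by
    intro p hp h0 i j hi hj
    have hpi := hπ p hp h0 i j hi hj
    obtain ⟨u, hu, hu'⟩ := hσ p hp (by rw [h0]; exact dvd_zero _) (by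
      rwa [h0, zero_add, blockStart_zero, blockStart_self (by positivity)])
    refine ⟨u, ?_, ?_⟩
    · rw [← hpi, hτ.1 _ ⟨p, hp, h0, rfl⟩, Equiv.symm_apply_apply, hu]
    · rwa [h0, zero_add, blockStart_zero, blockStart_self (by positivity), ← hi, ← hj,
        show toIdx hn i = i from Fin.ext (val_toIdx i.isLt),
        show toIdx hn j = j from Fin.ext (val_toIdx j.isLt)] at hu'
  refine ⟨key, fun i j hij => ?_, fun p r hr => hτ.2.2 p r (by revert r; decide)⟩
  -- Earlier results survive: a processor that is overwritten receives, by injectivity of the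
  -- layout, the result belonging to it; the others keep their contents.
  by_cases hM : M (LC (i, j))
  · obtain ⟨p, hp, h0, hq⟩ := hM
    have h := hπ p hp h0 ⟨_, hp.rowIdx_lt⟩ ⟨_, hp.colIdx_lt⟩ rfl rfl
    have := LC.injective (hq.trans h)
    simp only [Prod.mk.injEq] at this
    exact key p hp h0 i j (by rw [this.1]) (by rw [this.2])
  · obtain ⟨u, hu, hu'⟩ := hij
    exact ⟨u, by rw [hτ.2.1 _ hM, hu], hu'⟩

/-- The computation of a chunk of all blocks of `C`. -/
lemma reach_chunk (hn : 2 ^ d ≤ n) {N : ℕ} (hN : n / 2 ^ d + 1 ≤ N * chunk s d)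
    (LA LB LC : Layout n s) (c c' : ℕ) {σ : TermRegs n s 14} (hin : InputKept LA LB σ) :
    Reach d (fun τ => InputKept LA LB τ ∧ ChunkDone d LC c c' τ ∧
      ∀ i j, HasResult LC i j σ → HasResult LC i j τ)
      (N * (24 * s + 24 + layerBase s d * (10 * subEdge s d + 4)) + (2 * s + 5 * d) +
        (10 * s + 10)) σ := by
  have hn0 : 0 < n := lt_of_lt_of_le (by positivity) hn
  let Inv : ℕ → TermRegs n s 14 → Prop := fun ck τ =>
    InputKept LA LB τ ∧ Accumulated d hn0 c c' (ck * chunk s d) τ ∧ ∀ p, τ p 2 = σ p 2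
  refine ((Reach.loop (Inv := Inv) N (fun ck _ τ hτ =>
      (reach_chunk_product hn0 LA LB hτ.1 hτ.2.1).weaken le_rfl fun ρ hρ =>
        ⟨hτ.1.congr (fun p => hρ.2 p 0 (by decide)) (fun p => hρ.2 p 1 (by decide)), hρ.1,
          fun p => (hρ.2 p 2 (by decide)).trans (hτ.2.2 p)⟩)
      ⟨hin, fun p _ h => ?_, fun _ => rfl⟩).bind fun σ₁ h1 =>
    (reach_tree hn (σ := σ₁) (c := c) (c' := c') fun p hp _ => ?_)
      |>.bind fun σ₂ h2 => (reach_deliver hn0 LC h2.1).weaken le_rfl fun τ hτ => ?_).weaken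
    (by omega) fun _ h => h
  -- With no summands the claim is vacuous, so whatever an earlier chunk left in the accumulator
  -- need not be cleared.
  · simp only [zero_mul, sumEnd, add_zero] at h
    omega
  · have h := h1.2.1 p hp
    have h3 := blockStart_add_le (D := 2 ^ d) (N := n) (K := blk d p 1) (by positivity) 1
    rw [one_mul] at h3
    have h4 : sumEnd n d p (N * chunk s d) = blockStart (2 ^ d) n (blk d p 1 + 2 ^ 0) := by
      rw [sumEnd, pow_zero]
      omega
    rwa [h4] at h
  · refine ⟨h1.1.congr (fun p => ?_) (fun p => ?_), hτ.1, fun i j hij => hτ.2.1 i j ?_⟩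
    · rw [hτ.2.2 p 0 (by decide), h2.2 p 0 (by decide)]
    · rw [hτ.2.2 p 1 (by decide), h2.2 p 1 (by decide)]
    · obtain ⟨u, hu, hu'⟩ := hij
      exact ⟨u, by rw [h2.2 _ 2 (by decide), h1.2.2, hu], hu'⟩

/-- The whole algorithm. -/
lemma reach_product (hn : 2 ^ d ≤ n) (hs : 2 ^ d ≤ s) {N : ℕ}
    (hN : n / 2 ^ d + 1 ≤ N * chunk s d) (LA LB LC : Layout n s) {σ : TermRegs n s 14}
    (hin : InputKept LA LB σ) :
    Reach d (fun τ => ∀ i j, HasResult LC i j τ)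
      (N * N * (N * (24 * s + 24 + layerBase s d * (10 * subEdge s d + 4)) + (2 * s + 5 * d) +
        (10 * s + 10))) σ := by
  -- The chunks of `C` are numbered by two digits with base `N`; pass `m` handles the chunk `(m / N,
  -- m % N)`.
  let Inv : ℕ → TermRegs n s 14 → Prop := fun m τ =>
    InputKept LA LB τ ∧ ∀ c c', c' < N → c * N + c' < m → ChunkDone d LC c c' τ
  refine (Reach.loop (Inv := Inv) (N * N) (fun m hm τ hτ =>
    (reach_chunk hn hN LA LB LC (m / N) (m % N) hτ.1).weaken le_rfl fun ρ hρ =>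
      ⟨hρ.1, fun c c' hc' hlt => ?_⟩) ⟨hin, fun _ _ _ h => absurd h (Nat.not_lt_zero _)⟩).weaken
    le_rfl fun τ hτ i j => ?_
  · have hN0 : 0 < N := by omega
    rcases Nat.lt_succ_iff_lt_or_eq.1 hlt with h | h
    · intro p hp h0 i j hi hj
      exact hρ.2.2 i j (hτ.2 c c' hc' h p hp h0 i j hi hj)
    · subst h
      have := hρ.2.1
      rwa [mul_comm c N, Nat.mul_add_div hN0, Nat.div_eq_of_lt hc', add_zero, Nat.mul_add_mod,
        Nat.mod_eq_of_lt hc'] at this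
  · obtain ⟨c, hc, c', hc', p, hp, h0, hi, hj⟩ := exists_isPlace (β := 0) (γ := 2) (φ := 1)
      (by decide) (by decide) (by decide) hs hN i j
    exact hτ.2 c c' hc' (layer_lt hc hc') p hp h0 i j hi hj

end Stages

/-! ### Sizes -/

section Sizes

variable {α : ℝ} {n : ℕ}

lemma two_pow_depth_le (h2 : 2 ≤ α) (hn : 1 ≤ n) : (2 : ℝ) ^ depth α n ≤ (n : ℝ) ^ (α - 2) := by
  have hn' : (0 : ℝ) < n := by exact_mod_cast hn
  have h0 : 0 ≤ (α - 2) * Real.logb 2 n :=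
    mul_nonneg (by linarith) (Real.logb_nonneg (by norm_num) (by exact_mod_cast hn))
  calc (2 : ℝ) ^ depth α n = (2 : ℝ) ^ (depth α n : ℝ) := (Real.rpow_natCast _ _).symm
    _ ≤ (2 : ℝ) ^ ((α - 2) * Real.logb 2 n) :=
      Real.rpow_le_rpow_of_exponent_le (by norm_num) (Nat.floor_le h0)
    _ = (n : ℝ) ^ (α - 2) := by
      rw [mul_comm, Real.rpow_mul (by norm_num), Real.rpow_logb (by norm_num) (by norm_num) hn']

lemma rpow_le_two_mul_two_pow_depth (hn : 1 ≤ n) :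
    (n : ℝ) ^ (α - 2) ≤ 2 * (2 : ℝ) ^ depth α n := by
  have hn' : (0 : ℝ) < n := by exact_mod_cast hn
  calc (n : ℝ) ^ (α - 2) = (2 : ℝ) ^ ((α - 2) * Real.logb 2 n) := by
        rw [mul_comm, Real.rpow_mul (by norm_num), Real.rpow_logb (by norm_num) (by norm_num) hn']
    _ ≤ (2 : ℝ) ^ ((depth α n : ℝ) + 1) :=
      Real.rpow_le_rpow_of_exponent_le (by norm_num) (Nat.lt_floor_add_one _).le
    _ = 2 * (2 : ℝ) ^ depth α n := by
      rw [Real.rpow_add (by norm_num), Real.rpow_natCast, Real.rpow_one, mul_comm]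

/-- The relations between the sizes of the matrices, the mesh and the subcubes. -/
lemma size_bounds (h2 : 2 ≤ α) (h9 : α ≤ 9 / 4) (hn : 1 ≤ n) :
    2 ^ depth α n ≤ n ∧ 2 ^ depth α n ≤ edge α n ∧
    n / 2 ^ depth α n + 1 ≤ 18 * chunk (edge α n) (depth α n) ∧
    (edge α n : ℝ) ≤ 2 * (n : ℝ) ^ (3 - α) ∧
    (chunk (edge α n) (depth α n) : ℝ) ≤ 8 * (n : ℝ) ^ (3 - α) ∧ n ≤ edge α n ^ 3 := by
  have hn1 : (1 : ℝ) ≤ n := by exact_mod_cast hn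
  have hn0 : (0 : ℝ) < n := by linarith
  set s := edge α n with hs
  set d := depth α n with hd
  set L := subEdge s d with hL
  set l := layerBase s d with hl
  have D1 := two_pow_depth_le h2 hn
  have D2 := rpow_le_two_mul_two_pow_depth (α := α) hn
  have s1 : (n : ℝ) ^ (α / 3) ≤ s := Nat.le_ceil _
  have s2 : (s : ℝ) ≤ 2 * (n : ℝ) ^ (α / 3) := by
    have h1 : (s : ℝ) < (n : ℝ) ^ (α / 3) + 1 := Nat.ceil_lt_add_one (by positivity)
    have h2 : 1 ≤ (n : ℝ) ^ (α / 3) := Real.one_le_rpow hn1 (by linarith)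
    linarith
  -- `X`, `Y` and `E` stand for the side of a block, the edge of a subcube and the number of blocks
  -- per axis. The identity `X ^ 2 = Y ^ 3` says that a block has as many entries as a subcube has
  -- processors.
  obtain ⟨X, hX⟩ : ∃ X, X = (n : ℝ) ^ (3 - α) := ⟨_, rfl⟩
  obtain ⟨Y, hY⟩ : ∃ Y, Y = (n : ℝ) ^ (2 - 2 * α / 3) := ⟨_, rfl⟩
  obtain ⟨E, hE⟩ : ∃ E, E = (2 : ℝ) ^ d := ⟨_, rfl⟩
  rw [← hE] at D1 D2
  have hE0 : 0 < E := by rw [hE]; positivity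
  have hX1 : 1 ≤ X := by rw [hX]; exact Real.one_le_rpow hn1 (by linarith)
  have hY1 : 1 ≤ Y := by rw [hY]; exact Real.one_le_rpow hn1 (by linarith)
  have hXY : X ^ 2 = Y ^ 3 := by
    rw [hX, hY, ← Real.rpow_natCast, ← Real.rpow_natCast, ← Real.rpow_mul hn0.le,
      ← Real.rpow_mul hn0.le]
    congr 1
    push_cast
    ring
  have hYs : (n : ℝ) ^ (α / 3) = Y * (n : ℝ) ^ (α - 2) := by
    rw [hY, ← Real.rpow_add hn0]
    congr 1
    ring
  have hXn : (n : ℝ) = X * (n : ℝ) ^ (α - 2) := by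
    rw [hX, ← Real.rpow_add hn0]
    conv_lhs => rw [← Real.rpow_one (n : ℝ)]
    congr 1
    ring
  have F1 : 2 ^ d ≤ n := by
    have : (n : ℝ) ^ (α - 2) ≤ (n : ℝ) ^ (1 : ℝ) :=
      Real.rpow_le_rpow_of_exponent_le hn1 (by linarith)
    rw [Real.rpow_one] at this
    have h : ((2 ^ d : ℕ) : ℝ) ≤ n := by push_cast; rw [← hE]; linarith
    exact_mod_cast h
  have F2 : 2 ^ d ≤ s := by
    have : (n : ℝ) ^ (α - 2) ≤ (n : ℝ) ^ (α / 3) :=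
      Real.rpow_le_rpow_of_exponent_le hn1 (by linarith)
    have h : ((2 ^ d : ℕ) : ℝ) ≤ s := by push_cast; rw [← hE]; linarith
    exact_mod_cast h
  have hL1 : (1 : ℝ) ≤ L := by
    have : 0 < L := Nat.div_pos F2 (by positivity)
    exact_mod_cast this
  have hl1 : (1 : ℝ) ≤ l := by
    have : 0 < l := Nat.sqrt_pos.2 (by exact_mod_cast hL1)
    exact_mod_cast this
  have hLY : Y ≤ L + 1 := by
    have h1 : s < 2 ^ d * (L + 1) := Nat.lt_mul_div_succ s (by positivity)
    have h2 : (s : ℝ) < E * (L + 1) := by rw [hE]; exact_mod_cast h1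
    have h3 : Y * E ≤ Y * (n : ℝ) ^ (α - 2) := by gcongr
    have h4 : E * Y ≤ E * (L + 1) := by linarith
    exact le_of_mul_le_mul_left h4 hE0
  have hLY' : (L : ℝ) ≤ 4 * Y := by
    have h1 : L * 2 ^ d ≤ s := Nat.div_mul_le_self s _
    have h2 : (L : ℝ) * E ≤ s := by rw [hE]; exact_mod_cast h1
    have h3 : Y * (n : ℝ) ^ (α - 2) ≤ Y * (2 * E) := by gcongr
    have h4 : (L : ℝ) * E ≤ (4 * Y) * E := by linarith
    exact le_of_mul_le_mul_right h4 hE0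
  have hlL : (l : ℝ) ^ 2 ≤ L := by
    have : l ^ 2 ≤ L := Nat.sqrt_le' L
    exact_mod_cast this
  have hlL' : (L : ℝ) ≤ 4 * (l : ℝ) ^ 2 := by
    have h1 : L < (l + 1) ^ 2 := Nat.lt_succ_sqrt' L
    have h2 : (L : ℝ) < ((l : ℝ) + 1) ^ 2 := by exact_mod_cast h1
    nlinarith
  have hc : (chunk s d : ℝ) = L * l := by rw [chunk]; push_cast; rfl
  -- From `Y ≤ 2 L` and `L ≤ 4 l ^ 2` one gets `X ^ 2 = Y ^ 3 ≤ 8 L ^ 3 ≤ 32 (L l) ^ 2`.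
  have hXc : X ≤ 6 * (L * l) := by
    refine le_of_sq_le_sq ?_ (by positivity)
    have h1 : Y ^ 3 ≤ (2 * (L : ℝ)) ^ 3 := by gcongr; linarith
    have h2 : (L : ℝ) ^ 2 * L ≤ (L : ℝ) ^ 2 * (4 * (l : ℝ) ^ 2) := by gcongr
    rw [hXY]
    nlinarith
  have hcX : (L * l : ℝ) ≤ 8 * X := by
    refine le_of_sq_le_sq ?_ (by positivity)
    have h1 : (L : ℝ) ^ 3 ≤ (4 * Y) ^ 3 := by gcongr
    have h2 : (L : ℝ) ^ 2 * (l : ℝ) ^ 2 ≤ (L : ℝ) ^ 2 * L := by gcongr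
    rw [mul_pow 8 X, hXY]
    nlinarith
  refine ⟨F1, F2, ?_, ?_, ?_, ?_⟩
  -- `n / 2 ^ d + 1 ≤ 2 X + 1 ≤ 3 X`, and `3 * 6 = 18`.
  · have h1 : n / 2 ^ d * 2 ^ d ≤ n := Nat.div_mul_le_self n _
    have h2 : ((n / 2 ^ d : ℕ) : ℝ) * E ≤ n := by rw [hE]; exact_mod_cast h1
    have h3 : X * (n : ℝ) ^ (α - 2) ≤ X * (2 * E) := by gcongr
    have h4 : ((n / 2 ^ d : ℕ) : ℝ) * E ≤ (2 * X) * E := by linarith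
    have h5 := le_of_mul_le_mul_right h4 hE0
    have h6 : ((n / 2 ^ d + 1 : ℕ) : ℝ) ≤ (18 * chunk s d : ℕ) := by
      push_cast
      rw [hc]
      linarith
    exact_mod_cast h6
  · rw [← hX]
    -- Here `α ≤ 9 / 4` is decisive: crossing the mesh takes no longer than multiplying blocks.
    have : (n : ℝ) ^ (α / 3) ≤ X := by
      rw [hX]
      exact Real.rpow_le_rpow_of_exponent_le hn1 (by linarith)
    linarith
  · rw [hc, ← hX]; exact hcX
  · have h1 : ((n : ℝ) ^ (α / 3)) ^ 3 ≤ (s : ℝ) ^ 3 := by gcongr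
    rw [← Real.rpow_natCast, ← Real.rpow_mul hn0.le] at h1
    have h2 : (n : ℝ) ^ (1 : ℝ) ≤ (n : ℝ) ^ (α / 3 * (3 : ℕ)) :=
      Real.rpow_le_rpow_of_exponent_le hn1 (by push_cast; linarith)
    rw [Real.rpow_one] at h2
    exact_mod_cast h2.trans h1

/-- Coordinates and clock need three words; `C + 1 ≤ 2 ^ (C + 1)` lets further words absorb the
constant, so their number does not depend on `s`, however small the mesh is. -/
lemma card_ctrl_le {C s T : ℕ} (hT : T ≤ C * s ^ 3) :
    s ^ 3 * (T + 1) ≤ (s ^ 3 + 2) ^ (C + 3) := by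
  have h1 : C + 1 ≤ (s ^ 3 + 2) ^ (C + 1) :=
    (Nat.lt_two_pow_self (n := C + 1)).le.trans (Nat.pow_le_pow_left (by omega) _)
  calc s ^ 3 * (T + 1) ≤ (s ^ 3 + 2) * ((C + 1) * (s ^ 3 + 2)) := by
        refine Nat.mul_le_mul (by omega) ?_
        rw [show (C + 1) * (s ^ 3 + 2) = C * s ^ 3 + 2 * C + s ^ 3 + 2 by ring]
        omega
    _ ≤ (s ^ 3 + 2) * ((s ^ 3 + 2) ^ (C + 1) * (s ^ 3 + 2)) := by gcongr
    _ = (s ^ 3 + 2) ^ (C + 3) := by ring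

/-- The number of steps of the schedule. -/
lemma cost_le {s d L l N : ℕ} (hs : 2 ^ d ≤ s) (hL : 1 ≤ L) :
    N * N * (N * (24 * s + 24 + l * (10 * L + 4)) + (2 * s + 5 * d) + (10 * s + 10)) ≤
      N * N * (48 * N + 27) * (s + L * l) := by
  have h1 : d ≤ s := (Nat.lt_two_pow_self (n := d)).le.trans hs
  have h2 : 1 ≤ s := le_trans Nat.one_le_two_pow hs
  have h3 : l * (10 * L + 4) ≤ 14 * (L * l) := by nlinarith
  rw [mul_assoc (N * N)]
  refine Nat.mul_le_mul_left _ ?_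
  have h4 : N * (24 * s + 24 + l * (10 * L + 4)) ≤ N * (48 * (s + L * l)) :=
    Nat.mul_le_mul_left _ (by omega)
  calc _ ≤ N * (48 * (s + L * l)) + (2 * s + 5 * d) + (10 * s + 10) := by omega
    _ ≤ N * (48 * (s + L * l)) + 27 * (s + L * l) := by omega
    _ = (48 * N + 27) * (s + L * l) := by ring

lemma inputKept_initialRegs {n s : ℕ} (LA LB : Layout n s) :
    InputKept LA LB (initialRegs 0 1 LA LB (Matrix.of Term.entryA) (Matrix.of Term.entryB)) := by
  refine ⟨fun i k => ?_, fun k j => ?_⟩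
  · simp [initialRegs, stored, Function.partialInv_left LA.injective]
  · simp [initialRegs, stored, Function.partialInv_left LB.injective]

/-- Algorithm A, with 14 registers and a fixed number of control words per processor. -/
theorem exists_algorithmATakesTheta :
    ∃ w : ℕ, ∀ α : ℝ, 2 ≤ α → α ≤ 9 / 4 → AlgorithmATakesTheta.{u} 14 w α (3 - α) := by
  obtain ⟨C₀, hC₀⟩ : ∃ C₀ : ℕ, C₀ = 18 * 18 * (48 * 18 + 27) := ⟨_, rfl⟩
  refine ⟨(10 * C₀ + 2) + 3, fun α h2 h9 => ⟨1, 10 * C₀ + 2, one_pos, by positivity, ?_⟩⟩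
  intro n hn LA LB LC _ _ _
  obtain ⟨b1, b2, b3, b4, b5, b6⟩ := size_bounds h2 h9 hn
  have hn1 : (1 : ℝ) ≤ n := by exact_mod_cast hn
  have hX1 : 1 ≤ (n : ℝ) ^ (3 - α) := Real.one_le_rpow hn1 (by linarith)
  have hXn : (n : ℝ) ^ (3 - α) ≤ n := by
    conv_rhs => rw [← Real.rpow_one (n : ℝ)]
    exact Real.rpow_le_rpow_of_exponent_le hn1 (by linarith)
  have hs : 0 < edge α n := lt_of_lt_of_le (by positivity) b2
  -- The additional `⌈n ^ (3 - α)⌉` steps are idle; they give the lower bound on the running time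
  -- with constant 1.
  set T : ℕ := C₀ * (edge α n + chunk (edge α n) (depth α n)) + ⌈(n : ℝ) ^ (3 - α)⌉₊ with hT
  have hTu : (T : ℝ) ≤ (10 * C₀ + 2) * (n : ℝ) ^ (3 - α) := by
    have h1 : ((⌈(n : ℝ) ^ (3 - α)⌉₊ : ℕ) : ℝ) < (n : ℝ) ^ (3 - α) + 1 :=
      Nat.ceil_lt_add_one (by positivity)
    have h2 : (C₀ : ℝ) * (edge α n + chunk (edge α n) (depth α n)) ≤
        C₀ * (10 * (n : ℝ) ^ (3 - α)) := by
      gcongr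
      linarith
    rw [hT]
    push_cast
    linarith
  have hTl : (n : ℝ) ^ (3 - α) ≤ T := by
    have h1 := Nat.le_ceil ((n : ℝ) ^ (3 - α))
    have h2 : ⌈(n : ℝ) ^ (3 - α)⌉₊ ≤ T := Nat.le_add_left _ _
    exact h1.trans (by exact_mod_cast h2)
  -- Via `n ^ (3 - α) ≤ n ≤ s ^ 3` the clock is bounded by the mesh size times a constant
  -- independent of `α`, so `w` can be fixed before `α`.
  have hTs : T ≤ (10 * C₀ + 2) * edge α n ^ 3 := by
    have h1 : (T : ℝ) ≤ (10 * C₀ + 2) * n := hTu.trans (by gcongr)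
    have h2 : T ≤ (10 * C₀ + 2) * n := by exact_mod_cast h1
    exact h2.trans (Nat.mul_le_mul_left _ b6)
  have hL : 1 ≤ subEdge (edge α n) (depth α n) := Nat.div_pos b2 (by positivity)
  have hreach := (reach_product b1 b2 b3 LA LB LC (inputKept_initialRegs LA LB)).weaken
    ((cost_le b2 hL).trans (by rw [← hC₀]; exact Nat.le_add_right _ _ : _ ≤ T)) fun _ h => h
  obtain ⟨P, hP, hP'⟩ := exists_program_of_reach.{u} hs (card_ctrl_le hTs) (by decide) hreach
  exact ⟨P, T, hP, hP', by linarith, hTu⟩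

end Sizes

end Mesh

theorem theorem1 :
    (∃ R w : ℕ,
      (∀ α : ℝ, 2 ≤ α → α ≤ 9 / 4 → Mesh.AlgorithmATakesTheta.{u} R w α (3 - α)) ∧
      Mesh.AlgorithmATakesTheta.{u} R w (9 / 4) (3 / 4)) ∧
    ∃ c : ℝ, 0 < c ∧ ∀ (R w n s : ℕ) (P : Mesh.Program s R w) (LA LB LC : Mesh.Layout n s) (T : ℕ),
      Mesh.Program.ComputesWithin.{u} P LA LB LC T → c * (n : ℝ) ^ (3 / 4 : ℝ) ≤ T := by
  refine ⟨?_, 1 / 11, by norm_num, fun R w n s P LA LB LC T h => Mesh.rpow_le_of_computesWithin h⟩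
  obtain ⟨w, hw⟩ := Mesh.exists_algorithmATakesTheta.{u}
  refine ⟨14, w, hw, ?_⟩
  have := hw (9 / 4) (by norm_num) le_rfl
  rwa [show (3 : ℝ) - 9 / 4 = 3 / 4 by norm_num] at this
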